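/- **Setting.** Fix a signature of function symbols with arities, a set of variables, a total order $\gg$ (precedence) on the function symbols, and a weight function $w$ from function symbols to non-negative integers; $w_0$ is the smallest weight of a constant. A substitution moves only finitely many variables. The weight $|t|$ of a term $t$ is the linear expression with integer coefficients $\sum_f |t|_f\, w(f)+\sum_x |t|_x\, x$, where $|t|_p$ is the number of occurrences of $p$ in $t$; for a substitution $\sigma$, $\sigma(\alpha_0+\sum_i\alpha_i x_i)=\alpha_0+\sum_i\alpha_i|x_i\sigma|$. $\sigma$ is grounding for $e$ if $\sigma(e)$ contains no variable and $|x\sigma|\ge w_0$ for every variable $x$ for which $|x\sigma|$ is a constant. Write $e>0$ (resp. $e\gtrsim 0$) if $\sigma(e)>0$ (resp. $\sigma(e)\ge 0$) for all $\sigma$ grounding for $e$. *KBO*: $s\succ t$ iff (K1) $|s|-|t|>0$, or (K2) $|s|-|t|\gtrsim0$, $s=f(\bar s)$, $t=g(\bar t)$, $f\gg g$, or (K3) $|s|-|t|\gtrsim0$, $s=f(s_1,\dots,s_n)$, $t=f(t_1,\dots,t_n)$ and for some $i$, $s_i\succ t_i$ and $s_j=t_j$ for all $j<i$. *LPO*: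 for $s=f(s_1,\dots,s_n)$, $s\succ t$ iff (L1) $t=f(t_1,\dots,t_n)$ and for some $i$, $s_j=t_j$ for $j<i$, $s_i\succ t_i$, and $s\succ t_k$ for $k>i$, or (L2) $t=g(t_1,\dots,t_m)$, $f\gg g$ and $s\succ t_i$ for all $i$, or (L3) $s_i\succeq t$ for some $i$. A *term ordering diagram* (TOD) is a finite directed acyclic graph (parallel edges with different labels are allowed) with: a single root node, with one outgoing edge, from which every node is reachable; a single exit node, reachable from every node; term comparison nodes labeled $s\rhd t$, with three outgoing edges labeled $>,=,\ngeq$; positivity check nodes labeled $e\rhd 0$ ($e$ a linear expression), with three outgoing edges labeled $>,\ge,\ngeq$; success nodes labeled by an equality $l\simeq r$, with one outgoing edge. Given a relation $\succ$ on terms, $\sigma(s\rhd t)$ is $>$ if $s\sigma\succ t\sigma$, else $=$ if $s\sigma=t\sigma$, else $\ngeq$; and $\sigma(e\rhd0)$ is $>$ if $\sigma(e)>0$, else $\ge$ if $\sigma(e)\gtrsim0$, else $\ngeq$. The *traversal* for $\sigma$ is the path from root to exit that leaves every evaluation node (term comparison or positivity check) labeled $c$ along the edge labeled $\sigma(c)$;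 the *success set* of $\sigma$ is the set of labels of the success nodes on it. Two TODs are *equivalent* if every substitution has the same success set in both. An evaluation node $n$ labeled $c$ *forces* $\ell$ if $\sigma(c)=\ell$ for every $\sigma$ whose traversal reaches $n$. **Transformations.** Each is the local change below, followed by repeatedly removing non-root nodes without incoming edges until there are none. In the expansions, $n$ is a node labeled $s\rhd t$ with $s=f(s_1,\dots,s_k)$, $t=g(t_1,\dots,t_m)$, whose edges $>,=,\ngeq$ lead to $n_1,n_2,n_3$; $n$ is replaced by new nodes, and all edges into $n$ are redirected to the first of them. (If $f=g$, then $m=k$.) - *Redundant node removal*: if $n$ forces $\ell$ and its $\ell$-edge leads to $n_2$, redirect one edge into $n$ to $n_2$. - *Node replication*: if $n$ is a non-exit node with at least two incoming edges, redirect one of them to a new copy of $n$ with the same label and outgoing edges. - *KBO expansion*: the first new node is labeled $|s|-|t|\rhd0$, with $>$ leading to $n_1$ and $\ngeq$ to $n_3$. Its $\ge$-edge leads to $n_1$ if $f\gg g$, and to $n_3$ if $g\gg f$. If $f=g$, it leads to the first node of a chain of nodes $s_1\rhd t_1,\dots,s_k\rhd t_k$, each with $>$ leading to $n_1$, $\ngeq$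 to $n_3$, and $=$ to the next node of the chain, or to $n_2$ from the last one (for $k=0$ the $\ge$-edge leads to $n_2$). - *LPO expansion*, $f\gg g$: a chain $s\rhd t_1,\dots,s\rhd t_m$, each with $=$ and $\ngeq$ leading to $n_3$, and $>$ to the next node, or to $n_1$ from the last one. For $m=0$, $n_1$ replaces $n$. - *LPO expansion*, $g\gg f$: a chain $s_1\rhd t,\dots,s_k\rhd t$, each with $>$ and $=$ leading to $n_1$, and $\ngeq$ to the next node, or to $n_3$ from the last one. For $k=0$, $n_3$ replaces $n$. - *LPO expansion*, $f=g$: nodes $c_i$ labeled $s_i\rhd t_i$ ($1\le i\le k$), and nodes $a_i$ labeled $s\rhd t_i$ and $b_i$ labeled $s_i\rhd t$ ($2\le i\le k$); the first node is $c_1$. With $a_{k+1}=n_1$, $c_{k+1}=n_2$, $b_{k+1}=n_3$, the edges $>,=,\ngeq$ lead from $c_i$ to $a_{i+1},c_{i+1},b_{i+1}$, from $a_i$ to $a_{i+1},n_3,n_3$, and from $b_i$ to $n_1,n_1,b_{i+1}$. For $k=0$, $n_2$ replaces $n$. **Theorem (Correctness of TOD transformations).** (1) For every relation $\succ$ on terms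 (used for "forces"), there is no infinite sequence of TODs in which each arises from the previous one by one of these transformations. (2) Each transformation turns a TOD into a TOD that is equivalent to it: redundant node removal and node replication do so for every relation $\succ$ on terms, the KBO expansions if $\succ$ is the KBO for $\gg$ and $w$, and the LPO expansions if $\succ$ is the LPO for $\gg$. -/

import Mathlib

namespace TOD

universe u v x

/-! ### Terms, substitutions, linear expressions

Function symbols with arities are given by a first-order language `L` (its relation symbols play no
role), variables by a type `V`, terms by `L.Term V`. -/

/-- The function symbols of all arities. -/
abbrev Symbol (L : FirstOrder.Language.{u, v}) : Type u := Σ n : ℕ, L.Functions n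

variable {L : FirstOrder.Language.{u, v}} {V : Type x}

/-- A substitution: a map from variables to terms that moves only finitely many variables. -/
structure Subst (L : FirstOrder.Language.{u, v}) (V : Type x) where
  toFun : V → L.Term V
  finite_moved : {y | toFun y ≠ FirstOrder.Language.Term.var y}.Finite

/-- The term `tσ`. -/
def Subst.app (σ : Subst L V) (t : L.Term V) : L.Term V := t.subst σ.toFun

/-- Linear expressions over the variables with integer coefficients: the pair `(α₀, α)` is
`α₀ + ∑ y, α y * y`. -/
abbrev LinExpr (V : Type x) : Type x := ℤ × (V →₀ ℤ)

/-- The weight `|t|` of a term: each occurrence of a symbol `f` contributes `w f`, each occurrence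
of a variable `y` contributes `y`. -/
noncomputable def weight (w : Symbol L → ℕ) : L.Term V → LinExpr V
  | .var y => (0, Finsupp.single y 1)
  | .func (l := l) f ts => ((w ⟨l, f⟩ : ℤ), 0) + ∑ i, weight w (ts i)

/-- The linear expression `σ(α₀ + ∑ y, α y * y) = α₀ + ∑ y, α y * |yσ|`. -/
noncomputable def Subst.lin (w : Symbol L → ℕ) (σ : Subst L V) (e : LinExpr V) : LinExpr V :=
  (e.1, 0) + e.2.sum fun y a => a • weight w (σ.toFun y)

/-- The smallest weight of a constant. -/
noncomputable def minConstWeight (w : Symbol L → ℕ) : ℕ :=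
  sInf (Set.range fun c : L.Functions 0 => w ⟨0, c⟩)

/-- `σ` is grounding for `e`: `σ(e)` has no variables, and `|yσ| ≥ w₀` whenever `|yσ|` is a
constant expression. -/
def Grounding (w : Symbol L → ℕ) (σ : Subst L V) (e : LinExpr V) : Prop :=
  (σ.lin w e).2 = 0 ∧
    ∀ y : V, (weight w (σ.toFun y)).2 = 0 → (minConstWeight w : ℤ) ≤ (weight w (σ.toFun y)).1

/-- `e > 0`. -/
def LinPos (w : Symbol L → ℕ) (e : LinExpr V) : Prop :=
  ∀ σ : Subst L V, Grounding w σ e → 0 < (σ.lin w e).1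

/-- `e ≳ 0`. -/
def LinNonneg (w : Symbol L → ℕ) (e : LinExpr V) : Prop :=
  ∀ σ : Subst L V, Grounding w σ e → 0 ≤ (σ.lin w e).1

/-! ### Knuth-Bendix order and lexicographic path order

`prec f g` is the precedence `f ≫ g`. -/

/-- `s ≻ t` in the Knuth-Bendix order. -/
inductive KBO (prec : Symbol L → Symbol L → Prop) (w : Symbol L → ℕ) :
    L.Term V → L.Term V → Prop
  | pos {s t : L.Term V} : LinPos w (weight w s - weight w t) → KBO prec w s t
  | symbol {n m : ℕ} {f : L.Functions n} {g : L.Functions m}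
      {ss : Fin n → L.Term V} {ts : Fin m → L.Term V} :
      LinNonneg w (weight w (.func f ss) - weight w (.func g ts)) →
      prec ⟨n, f⟩ ⟨m, g⟩ → KBO prec w (.func f ss) (.func g ts)
  | args {n : ℕ} {f : L.Functions n} {ss ts : Fin n → L.Term V} (i : Fin n) :
      LinNonneg w (weight w (.func f ss) - weight w (.func f ts)) →
      KBO prec w (ss i) (ts i) → (∀ j, j < i → ss j = ts j) →
      KBO prec w (.func f ss) (.func f ts)

/-- `s ≻ t` in the lexicographic path order. -/
inductive LPO (prec : Symbol L → Symbol L → Prop) : L.Term V → L.Term V → Prop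
  | args {n : ℕ} {f : L.Functions n} {ss ts : Fin n → L.Term V} (i : Fin n) :
      (∀ j, j < i → ss j = ts j) → LPO prec (ss i) (ts i) →
      (∀ k, i < k → LPO prec (.func f ss) (ts k)) → LPO prec (.func f ss) (.func f ts)
  | symbol {n m : ℕ} {f : L.Functions n} {g : L.Functions m}
      {ss : Fin n → L.Term V} {ts : Fin m → L.Term V} :
      prec ⟨n, f⟩ ⟨m, g⟩ → (∀ i, LPO prec (.func f ss) (ts i)) →
      LPO prec (.func f ss) (.func g ts)
  | sub_eq {n : ℕ} {f : L.Functions n} {ss : Fin n → L.Term V} (i : Fin n) :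
      LPO prec (.func f ss) (ss i)
  | sub_gt {n : ℕ} {f : L.Functions n} {ss : Fin n → L.Term V} {t : L.Term V} (i : Fin n) :
      LPO prec (ss i) t → LPO prec (.func f ss) t

/-! ### Diagrams -/

/-- Edge labels; `next` marks the single, unlabeled outgoing edge of root and success nodes. -/
inductive EdgeLabel
  | next | gt | eq | geq | ngeq
  deriving DecidableEq

/-- The contents of a node: its kind, its label, and the targets of its outgoing edges. Nodes are
named by natural numbers. -/
inductive Node (L : FirstOrder.Language.{u, v}) (V : Type x)
  | root (next : ℕ)
  | exit
  /-- term comparison node -/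
  | cmp (s t : L.Term V) (gt eq ngeq : ℕ)
  /-- positivity check node -/
  | pos (e : LinExpr V) (gt geq ngeq : ℕ)
  /-- success node, labeled by the equality between `l` and `r` -/
  | success (l r : L.Term V) (next : ℕ)

namespace Node

/-- The target of the outgoing edge with a given label, if there is such an edge. -/
def succ : Node L V → EdgeLabel → Option ℕ
  | root a, .next => some a
  | cmp _ _ a _ _, .gt => some a
  | cmp _ _ _ b _, .eq => some b
  | cmp _ _ _ _ c, .ngeq => some c
  | pos _ a _ _, .gt => some a
  | pos _ _ b _, .geq => some b
  | pos _ _ _ c, .ngeq => some c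
  | success _ _ a, .next => some a
  | _, _ => none

/-- Change the edge targets: the edge labeled `ℓ` with target `m` gets the target `φ ℓ m`. -/
def mapEdges (φ : EdgeLabel → ℕ → ℕ) : Node L V → Node L V
  | root a => root (φ .next a)
  | exit => exit
  | cmp s t a b c => cmp s t (φ .gt a) (φ .eq b) (φ .ngeq c)
  | pos e a b c => pos e (φ .gt a) (φ .geq b) (φ .ngeq c)
  | success l r a => success l r (φ .next a)

/-- Evaluation nodes: term comparison nodes and positivity check nodes. -/
def IsEval : Node L V → Prop
  | cmp .. => True
  | pos .. => True
  | _ => False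

open Classical in
/-- The label of the outgoing edge that a traversal for `σ` follows, where terms are compared by
the relation `r` and weights are taken with respect to `w`. -/
noncomputable def evalLabel (r : L.Term V → L.Term V → Prop) (w : Symbol L → ℕ) (σ : Subst L V) :
    Node L V → EdgeLabel
  | cmp s t .. =>
      if r (σ.app s) (σ.app t) then .gt else if σ.app s = σ.app t then .eq else .ngeq
  | pos e .. =>
      if LinPos w (σ.lin w e) then .gt else if LinNonneg w (σ.lin w e) then .geq else .ngeq
  | _ => .next

end Node

/-- A directed graph with labeled edges (parallel edges are possible), whose nodes are the natural
numbers `n` for which `D n` is not `none`. -/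
abbrev Diagram (L : FirstOrder.Language.{u, v}) (V : Type x) := ℕ → Option (Node L V)

namespace Diagram

/-- There is an edge labeled `ℓ` from `n` to `m`. -/
def Edge (D : Diagram L V) (n : ℕ) (ℓ : EdgeLabel) (m : ℕ) : Prop :=
  ∃ nd, D n = some nd ∧ nd.succ ℓ = some m

def Adj (D : Diagram L V) (n m : ℕ) : Prop := ∃ ℓ, D.Edge n ℓ m

def IsRoot (D : Diagram L V) (n : ℕ) : Prop := ∃ a, D n = some (.root a)

def IsExit (D : Diagram L V) (n : ℕ) : Prop := D n = some .exit

end Diagram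

/-- Term ordering diagrams: finite directed acyclic graphs with a single root, from which every
node is reachable, and a single exit, which is reachable from every node. -/
structure IsTOD (D : Diagram L V) : Prop where
  finite : {n | D n ≠ none}.Finite
  edge_closed : ∀ n m, D.Adj n m → D m ≠ none
  acyclic : ∀ n, ¬ Relation.TransGen D.Adj n n
  root_unique : ∃! n, D.IsRoot n
  exit_unique : ∃! n, D.IsExit n
  reachable_from_root : ∀ a n, D.IsRoot a → D n ≠ none → Relation.ReflTransGen D.Adj a n
  exit_reachable : ∀ b n, D.IsExit b → D n ≠ none → Relation.ReflTransGen D.Adj n b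

section Traversal

variable (r : L.Term V → L.Term V → Prop) (w : Symbol L → ℕ)

/-- The traversal for `σ` at the node `n` goes on to the node `m`. -/
def FollowedEdge (D : Diagram L V) (σ : Subst L V) (n m : ℕ) : Prop :=
  ∃ nd, D n = some nd ∧ nd.succ (nd.evalLabel r w σ) = some m

/-- The path `p` (the list of its nodes) is the traversal of `D` for `σ`: it leads from the root to
the exit along the edges selected by `σ`. -/
def IsTraversal (D : Diagram L V) (σ : Subst L V) (p : List ℕ) : Prop :=
  (∃ a, D.IsRoot a ∧ p.head? = some a) ∧ (∃ b, D.IsExit b ∧ p.getLast? = some b) ∧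
    p.IsChain (FollowedEdge r w D σ)

/-- The traversal of `D` for `σ` reaches `n`. -/
def Reaches (D : Diagram L V) (σ : Subst L V) (n : ℕ) : Prop :=
  ∃ p, IsTraversal r w D σ p ∧ n ∈ p

/-- The success set of `σ` in `D`: all labels of success nodes on the traversal for `σ`. -/
def successSet (D : Diagram L V) (σ : Subst L V) : Set (L.Term V × L.Term V) :=
  {q | ∃ n m, Reaches r w D σ n ∧ D n = some (.success q.1 q.2 m)}

/-- Equivalence of diagrams. -/
def Equivalent (D₁ D₂ : Diagram L V) : Prop :=
  ∀ σ : Subst L V, successSet r w D₁ σ = successSet r w D₂ σ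

/-- The evaluation node `n` forces the edge label `ℓ`. -/
def Forces (D : Diagram L V) (n : ℕ) (ℓ : EdgeLabel) : Prop :=
  ∃ nd, D n = some nd ∧ nd.IsEval ∧ ∀ σ, Reaches r w D σ n → nd.evalLabel r w σ = ℓ

end Traversal

/-! ### Transformations

A transformation first changes the diagram locally and then removes, as long as possible, nodes
without incoming edges. -/

/-- Remove one non-root node that has no incoming edges. -/
def RemoveOrphan (D D' : Diagram L V) : Prop :=
  ∃ n, D n ≠ none ∧ ¬ D.IsRoot n ∧ (∀ m, ¬ D.Adj m n) ∧ D' = Function.update D n none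

/-- `D'` arises from `D` by removing nodes without incoming edges as long as there are any. -/
def Cleanup (D D' : Diagram L V) : Prop :=
  Relation.ReflTransGen RemoveOrphan D D' ∧ ∀ D'', ¬ RemoveOrphan D' D''

/-- `D'` arises from `D` by the local change `C` and the subsequent clean-up. -/
def Transforms (C : Diagram L V → Diagram L V → Prop) (D D' : Diagram L V) : Prop :=
  ∃ H, C D H ∧ Cleanup H D'

/-- Let the edge labeled `ℓ` that leaves `n` lead to `m`. -/
def Diagram.redirect (D : Diagram L V) (n : ℕ) (ℓ : EdgeLabel) (m : ℕ) : Diagram L V :=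
  Function.update D n ((D n).map (Node.mapEdges fun ℓ' a => if ℓ' = ℓ then m else a))

/-- The generic transformations: redundant node removal and node replication. -/
inductive GenericChange (r : L.Term V → L.Term V → Prop) (w : Symbol L → ℕ)
    (D : Diagram L V) : Diagram L V → Prop
  /-- `n` forces `ℓ`, and the edge from `n` labeled `ℓ` leads to `n₂`: an edge from `n₁` to `n` is
  redirected to `n₂`. -/
  | redundant {n₁ n n₂ : ℕ} {ℓ' ℓ : EdgeLabel} :
      D.Edge n₁ ℓ' n → Forces r w D n ℓ → D.Edge n ℓ n₂ →
      GenericChange r w D (D.redirect n₁ ℓ' n₂)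
  /-- `n` is a non-exit node with a second incoming edge: an edge from `n₁` to `n` is redirected to
  the new node `n₂`, a copy of `n`. -/
  | replicate {n₁ n n₂ n₃ : ℕ} {ℓ ℓ' : EdgeLabel} :
      D.Edge n₁ ℓ n → ¬ D.IsExit n → D.Edge n₃ ℓ' n → (n₃, ℓ') ≠ (n₁, ℓ) → D n₂ = none →
      GenericChange r w D (Function.update (D.redirect n₁ ℓ n₂) n₂ (D n))

/-- `H` arises from `D` by replacing the node `n` by the named nodes in the list `new`; the edges
that led to `n` lead to `entry` instead. The names in `new` are distinct and not in use in `D`,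
except that the name `n` itself may be used again. -/
structure Replaces (D H : Diagram L V) (n entry : ℕ) (new : List (ℕ × Node L V)) : Prop where
  nodup : (new.map Prod.fst).Nodup
  fresh : ∀ a ∈ new, a.1 = n ∨ D a.1 = none
  nodes : ∀ m nd, H m = some nd ↔ (m, nd) ∈ new ∨ (m ≠ n ∧
    ∃ nd₀, D m = some nd₀ ∧ nd = nd₀.mapEdges fun _ a => if a = n then entry else a)

/-- The expansions for the Knuth-Bendix order of a node `n` labeled with a comparison of
`f(s₁,…,s_k)` and `g(t₁,…,t_m)`. -/
inductive KBOChange (prec : Symbol L → Symbol L → Prop) (w : Symbol L → ℕ)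
    (D H : Diagram L V) : Prop
  | gt {k m : ℕ} {f : L.Functions k} {g : L.Functions m}
      {ss : Fin k → L.Term V} {ts : Fin m → L.Term V} {n n₁ n₂ n₃ p : ℕ} :
      D n = some (.cmp (.func f ss) (.func g ts) n₁ n₂ n₃) → prec ⟨k, f⟩ ⟨m, g⟩ →
      Replaces D H n p [(p, .pos (weight w (.func f ss) - weight w (.func g ts)) n₁ n₁ n₃)] →
      KBOChange prec w D H
  /-- The new nodes are the positivity check node `p` and, for each `i`, a comparison node named
  `c i`; the `=`-edges lead down this chain, which ends in `n₂`. -/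
  | eq {k : ℕ} {f : L.Functions k} {ss ts : Fin k → L.Term V} {n n₁ n₂ n₃ p : ℕ}
      (c : Fin (k + 1) → ℕ) :
      D n = some (.cmp (.func f ss) (.func f ts) n₁ n₂ n₃) → c (Fin.last k) = n₂ →
      Replaces D H n p
        ((p, .pos (weight w (.func f ss) - weight w (.func f ts)) n₁ (c 0) n₃) ::
          List.ofFn fun i : Fin k => (c i.castSucc, .cmp (ss i) (ts i) n₁ (c i.succ) n₃)) →
      KBOChange prec w D H
  | lt {k m : ℕ} {f : L.Functions k} {g : L.Functions m}
      {ss : Fin k → L.Term V} {ts : Fin m → L.Term V} {n n₁ n₂ n₃ p : ℕ} :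
      D n = some (.cmp (.func f ss) (.func g ts) n₁ n₂ n₃) → prec ⟨m, g⟩ ⟨k, f⟩ →
      Replaces D H n p [(p, .pos (weight w (.func f ss) - weight w (.func g ts)) n₁ n₃ n₃)] →
      KBOChange prec w D H

/-- The expansions for the lexicographic path order of a node `n` labeled with a comparison of
`f(s₁,…,s_k)` and `g(t₁,…,t_m)`. If there are no arguments to go through, no node is new and
`n` is replaced by `n₁`, `n₂` or `n₃`. -/
inductive LPOChange (prec : Symbol L → Symbol L → Prop) (D H : Diagram L V) : Prop
  | gt {k m : ℕ} {f : L.Functions k} {g : L.Functions m}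
      {ss : Fin k → L.Term V} {ts : Fin m → L.Term V} {n n₁ n₂ n₃ : ℕ} (c : Fin (m + 1) → ℕ) :
      D n = some (.cmp (.func f ss) (.func g ts) n₁ n₂ n₃) → prec ⟨k, f⟩ ⟨m, g⟩ →
      c (Fin.last m) = n₁ →
      Replaces D H n (c 0)
        (List.ofFn fun i : Fin m =>
          (c i.castSucc, .cmp (.func f ss) (ts i) (c i.succ) n₃ n₃)) →
      LPOChange prec D H
  /-- The middle column is named by `c`, the left one, which compares `f(s₁,…,s_k)` to the
  remaining `tᵢ`, by `a`, the right one, which compares the remaining `sᵢ` to `f(t₁,…,t_k)`, by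
  `b`. The left and the right column lack the first row. -/
  | eq {k : ℕ} {f : L.Functions k} {ss ts : Fin k → L.Term V} {n n₁ n₂ n₃ : ℕ}
      (c a b : Fin (k + 1) → ℕ) :
      D n = some (.cmp (.func f ss) (.func f ts) n₁ n₂ n₃) →
      c (Fin.last k) = n₂ → a (Fin.last k) = n₁ → b (Fin.last k) = n₃ →
      Replaces D H n (c 0)
        ((List.ofFn fun i : Fin k =>
            (c i.castSucc, .cmp (ss i) (ts i) (a i.succ) (c i.succ) (b i.succ))) ++
          ((List.finRange k).tail.map fun i =>
            (a i.castSucc, .cmp (.func f ss) (ts i) (a i.succ) n₃ n₃)) ++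
          ((List.finRange k).tail.map fun i =>
            (b i.castSucc, .cmp (ss i) (.func f ts) n₁ n₁ (b i.succ)))) →
      LPOChange prec D H
  | lt {k m : ℕ} {f : L.Functions k} {g : L.Functions m}
      {ss : Fin k → L.Term V} {ts : Fin m → L.Term V} {n n₁ n₂ n₃ : ℕ} (c : Fin (k + 1) → ℕ) :
      D n = some (.cmp (.func f ss) (.func g ts) n₁ n₂ n₃) → prec ⟨m, g⟩ ⟨k, f⟩ →
      c (Fin.last k) = n₃ →
      Replaces D H n (c 0)
        (List.ofFn fun i : Fin k =>
          (c i.castSucc, .cmp (ss i) (.func g ts) n₁ n₁ (c i.succ))) →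
      LPOChange prec D H

/-- Any of the transformations, where forced labels refer to the relation `r`. -/
def AnyChange (r : L.Term V → L.Term V → Prop) (prec : Symbol L → Symbol L → Prop)
    (w : Symbol L → ℕ) (D H : Diagram L V) : Prop :=
  GenericChange r w D H ∨ KBOChange prec w D H ∨ LPOChange prec D H

/-- The change `C` turns diagrams into equivalent ones. -/
def Preserves (r : L.Term V → L.Term V → Prop) (w : Symbol L → ℕ)
    (C : Diagram L V → Diagram L V → Prop) : Prop :=
  ∀ D D' : Diagram L V, IsTOD D → Transforms C D D' → IsTOD D' ∧ Equivalent r w D D'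

end TOD

namespace TOD

universe u v x

open Relation

variable {L : FirstOrder.Language.{u, v}} {V : Type x}

/-! ### Single nodes: edge targets, labels, evaluation -/

namespace Node

/-! All local changes follow one pattern, `IsModification`: some edges into a node `n` are
redirected to `alt`, finitely many nodes may be added whose edges lead to children of `n` or,
without cycles, to one another, and `n` may be dropped. This preserves all conditions on a diagram
except reachability and the existence of an exit (`IsRootedDAG`). The clean-up restores these: in a
finite acyclic graph without orphans, backward walks end in the root and forward walks in the exit
(`IsRootedDAG.isTOD`).

Equivalence: the success set is what the walk for `σ` collects from the root (`successFrom`). By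
induction on a rank it stays the same as soon as `alt` in the new diagram collects what `n`
collected in the old one, and only substitutions that reach `n` matter
(`IsModification.equivalent`); this is what makes forced labels usable. For KBO the claim is read
off the rules, because weights commute with substitutions (`lin_weight_sub`). For LPO the subterm
rule overlaps with the others; `LPO.arg` and `LPO.irrefl` show that the tests which the expansion
omits are irrelevant.

Termination: let W(n) = E(size of n) * (1 + sum of W over the edges leaving n), where E is
`expansionBound`. This measures the unfolding of the diagram into a tree. An expansion replaces a
node of size k+1 by fewer than 3(k+1) smaller nodes; each has at most three edges and so costs at
most a factor 4E(k). Hence E(k+1) = (4E(k))^(3(k+1)) makes W drop. Removing a redundant node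
replaces it by a child, which is smaller. As the recursion is strictly monotone, the drop is passed
on to the root. Replication does not increase W(root) but adds a node, and the number of nodes is at
most W(root) (`IsUnfoldingSize.ncard_le`). So the pair of W(root) and W(root) minus the number of
nodes decreases lexicographically. -/

theorem succ_mapEdges (φ : EdgeLabel → ℕ → ℕ) (nd : Node L V) (ℓ : EdgeLabel) :
    (nd.mapEdges φ).succ ℓ = (nd.succ ℓ).map (φ ℓ) := by
  cases nd <;> cases ℓ <;> rfl

theorem evalLabel_mapEdges (r : L.Term V → L.Term V → Prop) (w : Symbol L → ℕ) (σ : Subst L V)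
    (φ : EdgeLabel → ℕ → ℕ) (nd : Node L V) :
    (nd.mapEdges φ).evalLabel r w σ = nd.evalLabel r w σ := by
  cases nd <;> rfl

theorem mapEdges_id (nd : Node L V) : nd.mapEdges (fun _ a => a) = nd := by
  cases nd <;> rfl

/-- The set of equalities with which a node is labeled. -/
def equalities : Node L V → Set (L.Term V × L.Term V)
  | success l r _ => {(l, r)}
  | _ => ∅

theorem mem_equalities {nd : Node L V} {q : L.Term V × L.Term V} :
    q ∈ nd.equalities ↔ ∃ m, nd = success q.1 q.2 m := by
  cases nd <;> simp [equalities, Prod.ext_iff, eq_comm]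

theorem equalities_mapEdges (φ : EdgeLabel → ℕ → ℕ) (nd : Node L V) :
    (nd.mapEdges φ).equalities = nd.equalities := by
  cases nd <;> rfl

/-- Nodes that are neither root nor exit. -/
def IsInner : Node L V → Prop
  | root _ => False
  | exit => False
  | _ => True

theorem IsEval.isInner {nd : Node L V} (h : nd.IsEval) : nd.IsInner := by
  cases nd <;> trivial

theorem IsEval.equalities {nd : Node L V} (h : nd.IsEval) : nd.equalities = ∅ := by
  cases nd <;> first | rfl | cases h

theorem exists_succ_evalLabel (r : L.Term V → L.Term V → Prop) (w : Symbol L → ℕ) (σ : Subst L V)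
    {nd : Node L V} (h : nd ≠ exit) : ∃ m, nd.succ (nd.evalLabel r w σ) = some m := by
  cases nd with
  | exit => exact absurd rfl h
  | root a => exact ⟨a, rfl⟩
  | success l r a => exact ⟨a, rfl⟩
  | cmp s t a b c =>
    simp only [evalLabel]
    split_ifs <;> exact ⟨_, rfl⟩
  | pos e a b c =>
    simp only [evalLabel]
    split_ifs <;> exact ⟨_, rfl⟩

end Node

/-! ### Directed acyclic graphs -/

/-- The rank counts proper descendants: an edge from `a` to `b` makes those of `b` descendants of
`a`, and `b` itself is lost because it lies on no cycle. -/
theorem exists_rank_of_acyclic {α : Type*} {R : α → α → Prop} {S : Set α} (hS : S.Finite)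
    (hR : ∀ a b, R a b → a ∈ S ∧ b ∈ S) (hac : ∀ a, ¬ TransGen R a a) :
    ∃ ρ : α → ℕ, ∀ a b, R a b → ρ b < ρ a := by
  have hsub : ∀ a, {b | TransGen R a b} ⊆ S := by
    intro a b hb
    obtain ⟨c, -, hc⟩ := TransGen.tail'_iff.1 hb
    exact (hR _ _ hc).2
  refine ⟨fun a => {b | TransGen R a b}.ncard, fun a b hab => ?_⟩
  refine Set.ncard_lt_ncard ?_ (hS.subset (hsub a))
  exact (Set.ssubset_iff_of_subset fun c hc => TransGen.head hab hc).2
    ⟨b, TransGen.single hab, hac b⟩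

theorem acyclic_of_rank {α β : Type*} [Preorder β] {R : α → α → Prop} (ρ : α → β)
    (h : ∀ a b, R a b → ρ b < ρ a) (a : α) : ¬ TransGen R a a := by
  intro ha
  have : ∀ b, TransGen R a b → ρ b < ρ a := by
    intro b hb
    induction hb with
    | single h1 => exact h _ _ h1
    | tail _ h1 ih => exact (h _ _ h1).trans ih
  exact lt_irrefl _ (this a ha)

/-- The conditions on term ordering diagrams without those on reachability. -/
structure IsRootedDAG (D : Diagram L V) : Prop where
  finite : {n | D n ≠ none}.Finite
  edge_closed : ∀ n m, D.Adj n m → D m ≠ none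
  acyclic : ∀ n, ¬ TransGen D.Adj n n
  root_unique : ∃! n, D.IsRoot n
  exit_unique : ∀ a b, D.IsExit a → D.IsExit b → a = b

theorem IsTOD.isRootedDAG {D : Diagram L V} (h : IsTOD D) : IsRootedDAG D :=
  ⟨h.finite, h.edge_closed, h.acyclic, h.root_unique, fun _ _ ha hb => h.exit_unique.unique ha hb⟩

theorem Diagram.Adj.ne_none {D : Diagram L V} {n m : ℕ} (h : D.Adj n m) : D n ≠ none := by
  obtain ⟨ℓ, nd, h1, -⟩ := h
  simp [h1]

theorem Diagram.adj_of_succ {D : Diagram L V} {n m : ℕ} {nd : Node L V} {ℓ : EdgeLabel}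
    (h : D n = some nd) (h' : nd.succ ℓ = some m) : D.Adj n m :=
  ⟨ℓ, nd, h, h'⟩

namespace IsRootedDAG

variable {D : Diagram L V}

theorem exists_rank (h : IsRootedDAG D) : ∃ ρ : ℕ → ℕ, ∀ n m, D.Adj n m → ρ m < ρ n :=
  exists_rank_of_acyclic h.finite (fun a b hab => ⟨hab.ne_none, h.edge_closed a b hab⟩) h.acyclic

theorem exists_corank (h : IsRootedDAG D) : ∃ ρ : ℕ → ℕ, ∀ n m, D.Adj n m → ρ n < ρ m := by
  obtain ⟨ρ, hρ⟩ := exists_rank_of_acyclic (R := Function.swap D.Adj) h.finite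
    (fun a b hab => ⟨h.edge_closed b a hab, hab.ne_none⟩)
    (fun a ha => h.acyclic a (transGen_swap.1 ha))
  exact ⟨ρ, fun n m hnm => hρ m n hnm⟩

theorem ne_of_adj (h : IsRootedDAG D) {n m : ℕ} (hnm : D.Adj n m) : m ≠ n := by
  rintro rfl
  exact h.acyclic _ (TransGen.single hnm)

/-- Only the root may lack a predecessor and only an exit lacks a successor, so backward walks can
stop only in the root and forward walks only in an exit; the ranks bound their lengths. The walk
that starts in the root also provides the exit, whose existence `IsRootedDAG` does not demand. -/
theorem isTOD (h : IsRootedDAG D) (horph : ∀ n, D n ≠ none → ¬ D.IsRoot n → ∃ m, D.Adj m n) :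
    IsTOD D := by
  obtain ⟨ρ, hρ⟩ := h.exists_rank
  obtain ⟨ρ', hρ'⟩ := h.exists_corank
  have hroot : ∀ a n, D.IsRoot a → D n ≠ none → ReflTransGen D.Adj a n := by
    intro a n ha
    induction hk : ρ' n using Nat.strong_induction_on generalizing n with
    | _ k ih =>
      intro hn
      by_cases hr : D.IsRoot n
      · rw [h.root_unique.unique ha hr]
      · obtain ⟨m, hm⟩ := horph n hn hr
        exact (ih _ (hk ▸ hρ' _ _ hm) m rfl hm.ne_none).tail hm
  have hexit : ∀ n, D n ≠ none → ∃ b, D.IsExit b ∧ ReflTransGen D.Adj n b := by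
    intro n
    induction hk : ρ n using Nat.strong_induction_on generalizing n with
    | _ k ih =>
      intro hn
      by_cases hr : D.IsExit n
      · exact ⟨n, hr, .refl⟩
      · obtain ⟨nd, hnd⟩ := Option.ne_none_iff_exists'.1 hn
        have hne : nd ≠ .exit := by
          rintro rfl
          exact hr hnd
        have : ∃ ℓ m, nd.succ ℓ = some m := by
          cases nd with
          | exit => exact absurd rfl hne
          | root a => exact ⟨.next, a, rfl⟩
          | success l r a => exact ⟨.next, a, rfl⟩
          | cmp s t a b c => exact ⟨.gt, a, rfl⟩
          | pos e a b c => exact ⟨.gt, a, rfl⟩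
        obtain ⟨ℓ, m, hm⟩ := this
        have hadj := Diagram.adj_of_succ hnd hm
        obtain ⟨b, hb, hb'⟩ := ih _ (hk ▸ hρ _ _ hadj) m rfl (h.edge_closed _ _ hadj)
        exact ⟨b, hb, hb'.head hadj⟩
  refine ⟨h.finite, h.edge_closed, h.acyclic, h.root_unique, ?_, hroot, ?_⟩
  · obtain ⟨a, ⟨c, hc⟩, -⟩ := h.root_unique
    obtain ⟨b, hb, -⟩ := hexit a (by simp [hc])
    exact ⟨b, hb, fun b' hb' => h.exit_unique _ _ hb' hb⟩
  · intro b n hb hn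
    obtain ⟨b', hb', hr⟩ := hexit n hn
    rwa [h.exit_unique _ _ hb hb']

end IsRootedDAG

/-- The source of such an edge would be reachable from the root, which closes a cycle. -/
theorem IsTOD.not_adj_root {D : Diagram L V} (h : IsTOD D) {a n : ℕ} (ha : D.IsRoot a) :
    ¬ D.Adj n a := fun hn =>
  h.acyclic a (TransGen.tail' (h.reachable_from_root a n ha hn.ne_none) hn)

/-! ### Success sets -/

section Traversal

variable (r : L.Term V → L.Term V → Prop) (w : Symbol L → ℕ)

/-- The labels of the success nodes on the path that starts in `n` and follows `σ`. -/
def successFrom (D : Diagram L V) (σ : Subst L V) (n : ℕ) : Set (L.Term V × L.Term V) :=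
  {q | ∃ m k, ReflTransGen (FollowedEdge r w D σ) n m ∧ D m = some (.success q.1 q.2 k)}

variable {r w} {D : Diagram L V} {σ : Subst L V}

theorem FollowedEdge.adj {n m : ℕ} (h : FollowedEdge r w D σ n m) : D.Adj n m := by
  obtain ⟨nd, h1, h2⟩ := h
  exact Diagram.adj_of_succ h1 h2

/-- One step of the walk; inductions over diagrams use `successFrom` in this form. -/
theorem mem_successFrom_iff {n : ℕ} {nd : Node L V} (h : D n = some nd)
    {q : L.Term V × L.Term V} :
    q ∈ successFrom r w D σ n ↔ q ∈ nd.equalities ∨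
      ∃ c, nd.succ (nd.evalLabel r w σ) = some c ∧ q ∈ successFrom r w D σ c := by
  constructor
  · rintro ⟨m, k, hm, hk⟩
    rcases hm.cases_head with rfl | ⟨c, ⟨nd', h1, h2⟩, hc⟩
    · rw [h, Option.some_inj] at hk
      exact .inl (Node.mem_equalities.2 ⟨k, hk⟩)
    · rw [h, Option.some_inj] at h1
      subst h1
      exact .inr ⟨c, h2, m, k, hc, hk⟩
  · rintro (hq | ⟨c, hc, m, k, hm, hk⟩)
    · obtain ⟨k, rfl⟩ := Node.mem_equalities.1 hq
      exact ⟨n, k, .refl, h⟩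
    · exact ⟨m, k, hm.head ⟨nd, h, hc⟩, hk⟩

theorem successFrom_eq_of_isEval {n c : ℕ} {nd : Node L V} (h : D n = some nd) (he : nd.IsEval)
    (hc : nd.succ (nd.evalLabel r w σ) = some c) :
    successFrom r w D σ n = successFrom r w D σ c := by
  ext q
  rw [mem_successFrom_iff h, he.equalities, hc]
  simp

theorem IsTOD.exists_chain (h : IsTOD D) (σ : Subst L V) (n : ℕ) (hn : D n ≠ none) :
    ∃ l, (n :: l).IsChain (FollowedEdge r w D σ) ∧
      ∃ b, D.IsExit b ∧ (n :: l).getLast? = some b := by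
  obtain ⟨ρ, hρ⟩ := h.isRootedDAG.exists_rank
  induction hk : ρ n using Nat.strong_induction_on generalizing n with
  | _ k ih =>
    obtain ⟨nd, hnd⟩ := Option.ne_none_iff_exists'.1 hn
    by_cases hr : nd = .exit
    · subst hr
      exact ⟨[], by simp, n, hnd, by simp⟩
    · obtain ⟨m, hm⟩ := Node.exists_succ_evalLabel r w σ hr
      have hadj := Diagram.adj_of_succ hnd hm
      obtain ⟨l, hl, b, hb, hlast⟩ :=
        ih _ (hk ▸ hρ _ _ hadj) m (h.edge_closed _ _ hadj) rfl
      exact ⟨m :: l, List.isChain_cons_cons.2 ⟨⟨nd, hnd, hm⟩, hl⟩, b, hb, by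
        rw [List.getLast?_cons_cons, hlast]⟩

/-- A traversal has to run up to the exit, so a partial walk to `n` must be completed;
`IsTOD.exists_chain` does this. -/
theorem IsTOD.reaches_iff (h : IsTOD D) {a : ℕ} (ha : D.IsRoot a) {n : ℕ} :
    Reaches r w D σ n ↔ ReflTransGen (FollowedEdge r w D σ) a n := by
  constructor
  · rintro ⟨p, ⟨⟨a', ha', hp⟩, -, hc⟩, hn⟩
    obtain rfl := h.root_unique.unique ha ha'
    obtain ⟨l, rfl⟩ := List.head?_eq_some_iff.1 hp
    have hall : ∀ x ∈ a :: l, ReflTransGen (FollowedEdge r w D σ) a x :=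
      hc.induction _ _ (fun _ _ hxy hx => hx.tail hxy) (by simp [ReflTransGen.refl])
    exact hall n hn
  · intro hr
    have key : ∃ l, (a :: l).IsChain (FollowedEdge r w D σ) ∧
        (∃ b, D.IsExit b ∧ (a :: l).getLast? = some b) ∧ n ∈ a :: l := by
      have hn : D n ≠ none := by
        rcases hr.cases_tail with rfl | ⟨c, -, hc⟩
        · obtain ⟨c, hc⟩ := ha
          simp [hc]
        · exact h.edge_closed _ _ hc.adj
      clear ha
      induction hr using ReflTransGen.head_induction_on with
      | refl =>
        obtain ⟨l, hl, hb⟩ := h.exists_chain (r := r) (w := w) σ n hn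
        exact ⟨l, hl, hb, by simp⟩
      | @head x y h1 _ ih =>
        obtain ⟨l, hl, ⟨b, hb, hlast⟩, hmem⟩ := ih
        exact ⟨y :: l, List.isChain_cons_cons.2 ⟨h1, hl⟩,
          ⟨b, hb, by rw [List.getLast?_cons_cons, hlast]⟩, List.mem_cons_of_mem _ hmem⟩
    obtain ⟨l, hl, hb, hmem⟩ := key
    exact ⟨a :: l, ⟨⟨a, ha, rfl⟩, hb, hl⟩, hmem⟩

theorem IsTOD.successSet_eq (h : IsTOD D) {a : ℕ} (ha : D.IsRoot a) :
    successSet r w D σ = successFrom r w D σ a := by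
  ext q
  simp only [successSet, successFrom, h.reaches_iff ha, Set.mem_ofPred_eq, exists_and_left]

end Traversal

/-! ### Removal of orphans -/

section Cleanup

variable {D D' : Diagram L V}

theorem update_none_eq_some {n m : ℕ} {nd : Node L V} :
    Function.update D n none m = some nd ↔ m ≠ n ∧ D m = some nd := by
  by_cases h : m = n
  · subst h; simp
  · simp [h]

theorem RemoveOrphan.le (h : RemoveOrphan D D') {m : ℕ} {nd : Node L V} (hm : D' m = some nd) :
    D m = some nd := by
  obtain ⟨n, -, -, -, rfl⟩ := h
  exact (update_none_eq_some.1 hm).2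

theorem RemoveOrphan.adj (h : RemoveOrphan D D') {n m : ℕ} (hm : D'.Adj n m) : D.Adj n m := by
  obtain ⟨ℓ, nd, h1, h2⟩ := hm
  exact ⟨ℓ, nd, h.le h1, h2⟩

theorem RemoveOrphan.isRoot_iff (h : RemoveOrphan D D') {a : ℕ} : D'.IsRoot a ↔ D.IsRoot a := by
  constructor
  · rintro ⟨c, hc⟩
    exact ⟨c, h.le hc⟩
  · obtain ⟨n, -, hroot, -, rfl⟩ := h
    rintro ⟨c, hc⟩
    exact ⟨c, update_none_eq_some.2 ⟨by rintro rfl; exact hroot ⟨c, hc⟩, hc⟩⟩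

theorem RemoveOrphan.isRootedDAG (h : RemoveOrphan D D') (hD : IsRootedDAG D) :
    IsRootedDAG D' where
  finite := hD.finite.subset fun n hn => by
    obtain ⟨nd, hnd⟩ := Option.ne_none_iff_exists'.1 hn
    simp [h.le hnd]
  edge_closed := by
    intro n m hnm
    have hm := hD.edge_closed _ _ (h.adj hnm)
    have hnm' := h.adj hnm
    obtain ⟨k, -, -, horph, rfl⟩ := h
    have hmk : m ≠ k := by
      rintro rfl
      exact horph _ hnm'
    simpa [Function.update_of_ne hmk] using hm
  acyclic := fun n hn => hD.acyclic n (TransGen.mono (fun _ _ hab => h.adj hab) _ _ hn)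
  root_unique := by
    simpa only [h.isRoot_iff] using hD.root_unique
  exit_unique := fun a b ha hb => hD.exit_unique a b (h.le ha) (h.le hb)

/-- A walk from the root never visits the removed node, which is neither the root nor the target of
an edge. -/
theorem RemoveOrphan.successFrom_root (h : RemoveOrphan D D') {a : ℕ} (ha : D.IsRoot a)
    (r : L.Term V → L.Term V → Prop) (w : Symbol L → ℕ) (σ : Subst L V) :
    successFrom r w D' σ a = successFrom r w D σ a := by
  ext q
  constructor
  · rintro ⟨m, k, hm, hk⟩
    refine ⟨m, k, ReflTransGen.mono ?_ _ _ hm, h.le hk⟩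
    rintro x y ⟨nd, h1, h2⟩
    exact ⟨nd, h.le h1, h2⟩
  · rintro ⟨m, k, hm, hk⟩
    obtain ⟨n, -, hroot, horph, rfl⟩ := h
    have hne : ∀ x, ReflTransGen (FollowedEdge r w D σ) a x → x ≠ n := by
      rintro x hx rfl
      rcases hx.cases_tail with rfl | ⟨c, -, hc⟩
      · exact hroot ha
      · exact horph _ hc.adj
    refine ⟨m, k, ?_, update_none_eq_some.2 ⟨hne m hm, hk⟩⟩
    clear hk
    induction hm with
    | refl => exact .refl
    | tail h1 h2 ih =>
      obtain ⟨nd, h3, h4⟩ := h2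
      exact ih.tail ⟨nd, update_none_eq_some.2 ⟨hne _ h1, h3⟩, h4⟩

theorem Cleanup.induction {P : Diagram L V → Prop} (h : Cleanup D D') (h0 : P D)
    (hs : ∀ E E', P E → RemoveOrphan E E' → P E') : P D' := by
  obtain ⟨h, -⟩ := h
  induction h with
  | refl => exact h0
  | tail _ h2 ih => exact hs _ _ ih h2

/-- Removals keep a rooted acyclic graph, and that none is possible any more is the hypothesis of
`IsRootedDAG.isTOD`. -/
theorem Cleanup.isTOD (h : Cleanup D D') (hD : IsRootedDAG D) : IsTOD D' := by
  refine IsRootedDAG.isTOD (h.induction hD fun E E' hE hr => hr.isRootedDAG hE) ?_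
  intro n hn hroot
  by_contra! hc
  exact h.2 _ ⟨n, hn, hroot, hc, rfl⟩

theorem Cleanup.isRoot_iff (h : Cleanup D D') {a : ℕ} : D'.IsRoot a ↔ D.IsRoot a :=
  h.induction (P := fun E => E.IsRoot a ↔ D.IsRoot a) Iff.rfl
    fun _ _ hE hr => hr.isRoot_iff.trans hE

theorem Cleanup.le (h : Cleanup D D') {m : ℕ} {nd : Node L V} (hm : D' m = some nd) :
    D m = some nd :=
  h.induction (P := fun E => E m = some nd → D m = some nd) id
    (fun _ _ hE hr hm => hE (hr.le hm)) hm

theorem Cleanup.successFrom_root (h : Cleanup D D') {a : ℕ} (ha : D.IsRoot a)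
    (r : L.Term V → L.Term V → Prop) (w : Symbol L → ℕ) (σ : Subst L V) :
    successFrom r w D' σ a = successFrom r w D σ a :=
  (h.induction (P := fun E => E.IsRoot a ∧ successFrom r w E σ a = successFrom r w D σ a)
    ⟨ha, rfl⟩ fun _ _ hE hr =>
      ⟨hr.isRoot_iff.2 hE.1, (hr.successFrom_root hE.1 r w σ).trans hE.2⟩).2

end Cleanup

/-! ### Local modifications -/

section Modification

variable {D H : Diagram L V} {n alt : ℕ} {keep : Prop} {N : Set ℕ}

/-- Edges to `a` may lead to `a'` after edges into `n` have been redirected to `alt`; the node `n`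
remains in place only if `keep` holds. -/
def Corresponds (n alt : ℕ) (keep : Prop) (a a' : ℕ) : Prop :=
  (a' = a ∧ (a ≠ n ∨ keep)) ∨ (a = n ∧ a' = alt)

theorem Corresponds.eq {a a' : ℕ} (h : Corresponds n alt keep a a') (ha : a ≠ n) : a' = a := by
  rcases h with h | h
  · exact h.1
  · exact absurd h.1 ha

theorem Corresponds.of_ne {a : ℕ} (ha : a ≠ n) : Corresponds n alt keep a a :=
  .inl ⟨rfl, .inl ha⟩

/-- `H` arises from `D` by redirecting edges that lead to the node `n` to `alt`, where nodes with
names in `N` are added, and `n` is removed unless `keep` holds. -/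
structure IsModification (D H : Diagram L V) (n alt : ℕ) (keep : Prop) (N : Set ℕ) : Prop where
  inner : ∃ nd, D n = some nd ∧ nd.IsInner
  fresh : ∀ m ∈ N, (m = n ∧ ¬ keep) ∨ D m = none
  finite : N.Finite
  old : ∀ m nd, D m = some nd → (m ≠ n ∨ keep) → ∃ φ, H m = some (nd.mapEdges φ) ∧
    ∀ ℓ a, nd.succ ℓ = some a → Corresponds n alt keep a (φ ℓ a)
  exhaustive : ∀ m, H m ≠ none → m ∈ N ∨ (D m ≠ none ∧ (m ≠ n ∨ keep))
  new : ∃ depth : ℕ → ℕ, ∀ m ∈ N, ∃ nd, H m = some nd ∧ nd.IsInner ∧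
    ∀ ℓ c, nd.succ ℓ = some c → (c ∈ N ∧ depth c < depth m) ∨ D.Adj n c
  alt_mem : alt ∈ N ∨ D.Adj n alt
  redirected : ∃ n₁ ℓ nd nd', D n₁ = some nd ∧ nd.succ ℓ = some n ∧ H n₁ = some nd' ∧
    nd'.succ ℓ = some alt

namespace IsModification

theorem not_mem (h : IsModification D H n alt keep N) {m : ℕ} (hm : D m ≠ none)
    (hm' : m ≠ n ∨ keep) : m ∉ N := by
  intro hmN
  rcases h.fresh m hmN with h1 | h1 <;> tauto

theorem ne_none_of_corresponds (h : IsModification D H n alt keep N) (hD : IsRootedDAG D)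
    {m m' : ℕ} (hm : D m ≠ none) (hc : Corresponds n alt keep m m') : H m' ≠ none := by
  have hold : ∀ a, D a ≠ none → (a ≠ n ∨ keep) → H a ≠ none := by
    intro a ha ha'
    obtain ⟨nd, hnd⟩ := Option.ne_none_iff_exists'.1 ha
    obtain ⟨φ, hφ, -⟩ := h.old a nd hnd ha'
    simp [hφ]
  rcases hc with ⟨rfl, hk⟩ | ⟨rfl, rfl⟩
  · exact hold _ hm hk
  · rcases h.alt_mem with h1 | h1
    · obtain ⟨depth, hnew⟩ := h.new
      obtain ⟨nd, hnd, -⟩ := hnew _ h1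
      simp [hnd]
    · exact hold _ (hD.edge_closed _ _ h1) (.inl (hD.ne_of_adj h1))

theorem adj_cases (h : IsModification D H n alt keep N) {m c : ℕ} (hmc : H.Adj m c) :
    m ∈ N ∨ (m ∉ N ∧ ∃ a, D.Adj m a ∧ Corresponds n alt keep a c) := by
  by_cases hmN : m ∈ N
  · exact .inl hmN
  refine .inr ⟨hmN, ?_⟩
  obtain ⟨hm, hk⟩ := (h.exhaustive m hmc.ne_none).resolve_left hmN
  obtain ⟨nd, hnd⟩ := Option.ne_none_iff_exists'.1 hm
  obtain ⟨φ, hφ, hcor⟩ := h.old m nd hnd hk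
  obtain ⟨ℓ, nd', h1, h2⟩ := hmc
  obtain rfl := Option.some_inj.1 (h1.symm.trans hφ)
  rw [Node.succ_mapEdges, Option.map_eq_some_iff] at h2
  obtain ⟨a, ha, rfl⟩ := h2
  exact ⟨a, Diagram.adj_of_succ hnd ha, hcor ℓ a ha⟩

theorem isRoot_iff (h : IsModification D H n alt keep N) {a : ℕ} : H.IsRoot a ↔ D.IsRoot a := by
  obtain ⟨depth, hnew⟩ := h.new
  obtain ⟨ndn, hn, hin⟩ := h.inner
  constructor
  · rintro ⟨c, hc⟩
    rcases h.exhaustive a (by simp [hc]) with haN | ⟨ha, hk⟩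
    · obtain ⟨nd, hnd, hi, -⟩ := hnew a haN
      rw [hc, Option.some_inj] at hnd
      subst hnd
      exact hi.elim
    · obtain ⟨nd, hnd⟩ := Option.ne_none_iff_exists'.1 ha
      obtain ⟨φ, hφ, -⟩ := h.old a nd hnd hk
      rw [hc, Option.some_inj] at hφ
      cases nd <;> simp [Node.mapEdges] at hφ
      exact ⟨_, hnd⟩
  · rintro ⟨c, hc⟩
    have hne : a ≠ n := by
      rintro rfl
      rw [hc, Option.some_inj] at hn
      subst hn
      exact hin.elim
    obtain ⟨φ, hφ, -⟩ := h.old a _ hc (.inl hne)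
    exact ⟨_, hφ⟩

theorem isExit_of_isExit (h : IsModification D H n alt keep N) {a : ℕ} (ha : H.IsExit a) :
    D.IsExit a := by
  obtain ⟨depth, hnew⟩ := h.new
  rw [Diagram.IsExit] at ha
  rcases h.exhaustive a (by simp [ha]) with haN | ⟨ha', hk⟩
  · obtain ⟨nd, hnd, hi, -⟩ := hnew a haN
    rw [ha, Option.some_inj] at hnd
    subst hnd
    exact hi.elim
  · obtain ⟨nd, hnd⟩ := Option.ne_none_iff_exists'.1 ha'
    obtain ⟨φ, hφ, -⟩ := h.old a nd hnd hk
    rw [ha, Option.some_inj] at hφ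
    cases nd <;> simp [Node.mapEdges] at hφ
    exact hnd

open Classical in
theorem isRootedDAG (h : IsModification D H n alt keep N) (hD : IsRootedDAG D) :
    IsRootedDAG H where
  finite := (h.finite.union hD.finite).subset fun m hm => by
    rcases h.exhaustive m hm with h1 | h1
    · exact .inl h1
    · exact .inr h1.1
  edge_closed := by
    intro m c hmc
    rcases h.adj_cases hmc with hmN | ⟨-, a, ha, hcor⟩
    · obtain ⟨depth, hnew⟩ := h.new
      obtain ⟨nd, hnd, -, hch⟩ := hnew m hmN
      obtain ⟨ℓ, nd', h1, h2⟩ := hmc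
      obtain rfl := Option.some_inj.1 (h1.symm.trans hnd)
      rcases hch ℓ c h2 with ⟨hcN, -⟩ | hc
      · obtain ⟨nd, hnd, -⟩ := hnew c hcN
        simp [hnd]
      · exact h.ne_none_of_corresponds hD (hD.edge_closed _ _ hc)
          (.of_ne (hD.ne_of_adj hc))
    · exact h.ne_none_of_corresponds hD (hD.edge_closed _ _ ha) hcor
  acyclic := by
    obtain ⟨depth, hnew⟩ := h.new
    obtain ⟨ρ, hρ⟩ := hD.exists_rank
    have hchild : ∀ c, D.Adj n c → c ∉ N := fun c hc =>
      h.not_mem (hD.edge_closed _ _ hc) (.inl (hD.ne_of_adj hc))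
    -- New nodes inherit the rank of `n` and are ordered among themselves by depth. Redirected edges
    -- then still go down, and so do edges from new nodes to children of `n`.
    refine acyclic_of_rank
      (fun m => toLex (if m ∈ N then (ρ n, depth m + 1) else (ρ m, 0))) fun m c hmc => ?_
    rcases h.adj_cases hmc with hmN | ⟨hmN, a, ha, hcor⟩
    · obtain ⟨nd, hnd, -, hch⟩ := hnew m hmN
      obtain ⟨ℓ, nd', h1, h2⟩ := hmc
      obtain rfl := Option.some_inj.1 (h1.symm.trans hnd)
      rcases hch ℓ c h2 with ⟨hcN, hlt⟩ | hc
      · simp [hmN, hcN, Prod.Lex.toLex_lt_toLex, hlt]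
      · simp [hmN, hchild c hc, Prod.Lex.toLex_lt_toLex, hρ _ _ hc]
    · rcases hcor with ⟨rfl, hk⟩ | ⟨rfl, rfl⟩
      · simp [hmN, h.not_mem (hD.edge_closed _ _ ha) hk, Prod.Lex.toLex_lt_toLex, hρ _ _ ha]
      · rcases h.alt_mem with h1 | h1
        · simp [hmN, h1, Prod.Lex.toLex_lt_toLex, hρ _ _ ha]
        · simp [hmN, hchild _ h1, Prod.Lex.toLex_lt_toLex, (hρ _ _ h1).trans (hρ _ _ ha)]
  root_unique := by simpa only [h.isRoot_iff] using hD.root_unique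
  exit_unique := fun a b ha hb =>
    hD.exit_unique a b (h.isExit_of_isExit ha) (h.isExit_of_isExit hb)

variable {r : L.Term V → L.Term V → Prop} {w : Symbol L → ℕ} {σ : Subst L V}

/-- The induction runs only over nodes that the walk for `σ` reaches in `D`. Without this
restriction `halt` could not be supplied for redundant nodes, where the label is known only for
substitutions that reach `n`. -/
theorem successFrom_eq (h : IsModification D H n alt keep N) (hD : IsRootedDAG D) {root : ℕ}
    (hroot : D.IsRoot root)
    (halt : ReflTransGen (FollowedEdge r w D σ) root n →
      (∀ c, D.Adj n c → FollowedEdge r w D σ n c →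
        successFrom r w H σ c = successFrom r w D σ c) →
      successFrom r w H σ alt = successFrom r w D σ n) :
    successFrom r w H σ root = successFrom r w D σ root := by
  obtain ⟨ρ, hρ⟩ := hD.exists_rank
  obtain ⟨ndn, hn, hin⟩ := h.inner
  have key : ∀ m m', ReflTransGen (FollowedEdge r w D σ) root m → D m ≠ none →
      Corresponds n alt keep m m' → successFrom r w H σ m' = successFrom r w D σ m := by
    intro m
    induction hk : ρ m using Nat.strong_induction_on generalizing m with
    | _ k ih =>
      intro m' hreach hm hcor
      rcases hcor with ⟨rfl, hkeep⟩ | ⟨rfl, rfl⟩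
      · obtain ⟨nd, hnd⟩ := Option.ne_none_iff_exists'.1 hm
        obtain ⟨φ, hφ, hcor⟩ := h.old _ nd hnd hkeep
        ext q
        rw [mem_successFrom_iff hnd, mem_successFrom_iff hφ, Node.equalities_mapEdges,
          Node.evalLabel_mapEdges, Node.succ_mapEdges]
        refine or_congr_right ?_
        cases hs : nd.succ (nd.evalLabel r w σ) with
        | none => simp
        | some c =>
          have hadj := Diagram.adj_of_succ hnd hs
          have := ih _ (hk ▸ hρ _ _ hadj) c rfl (φ (nd.evalLabel r w σ) c)
            (hreach.tail ⟨nd, hnd, hs⟩) (hD.edge_closed _ _ hadj) (hcor _ _ hs)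
          simp [this]
      · refine halt hreach fun c hc hf => ?_
        exact ih _ (hk ▸ hρ _ _ hc) c rfl c (hreach.tail hf) (hD.edge_closed _ _ hc)
          (.of_ne (hD.ne_of_adj hc))
  have hne : root ≠ n := by
    obtain ⟨c, hc⟩ := hroot
    rintro rfl
    rw [hc, Option.some_inj] at hn
    subst hn
    exact hin.elim
  obtain ⟨c, hc⟩ := hroot
  exact key root root .refl (by simp [hc]) (.of_ne hne)

theorem equivalent (h : IsModification D H n alt keep N) (hD : IsTOD D)
    {D' : Diagram L V} (hc : Cleanup H D')
    (halt : ∀ σ, Reaches r w D σ n →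
      (∀ c, FollowedEdge r w D σ n c → successFrom r w H σ c = successFrom r w D σ c) →
      successFrom r w H σ alt = successFrom r w D σ n) :
    Equivalent r w D D' := by
  intro σ
  obtain ⟨root, hroot, -⟩ := hD.root_unique
  have hH := h.isRootedDAG hD.isRootedDAG
  have hroot' := h.isRoot_iff.2 hroot
  rw [hD.successSet_eq hroot, (hc.isTOD hH).successSet_eq (hc.isRoot_iff.2 hroot'),
    hc.successFrom_root hroot', h.successFrom_eq hD.isRootedDAG hroot]
  intro hreach hch
  exact halt σ ((hD.reaches_iff hroot).2 hreach) fun c hf => hch c hf.adj hf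

end IsModification

end Modification

/-! ### The size of the unfolding of a diagram -/

/-- The number of symbols of a term. -/
def termSize : L.Term V → ℕ
  | .var _ => 1
  | .func _ ts => 1 + ∑ i, termSize (ts i)

/-- A bound for the size of the complete expansion of a comparison of size `k`. -/
def expansionBound : ℕ → ℕ
  | 0 => 1
  | k + 1 => (4 * expansionBound k) ^ (3 * (k + 1))

theorem expansionBound_pos (k : ℕ) : 0 < expansionBound k := by
  induction k with
  | zero => exact Nat.one_pos
  | succ k ih => exact pow_pos (by omega) _

theorem expansionBound_mono : Monotone expansionBound := by
  refine monotone_nat_of_le_succ fun k => ?_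
  calc expansionBound k ≤ 4 * expansionBound k := by omega
    _ ≤ (4 * expansionBound k) ^ (3 * (k + 1)) := Nat.le_self_pow (by omega) _

namespace Node

/-- The size of the comparison at a node. -/
def size : Node L V → ℕ
  | cmp s t .. => termSize s + termSize t
  | _ => 0

/-- The sum of `W` over the targets of the outgoing edges. -/
def succSum (W : ℕ → ℕ) : Node L V → ℕ
  | root a => W a
  | exit => 0
  | cmp _ _ a b c => W a + W b + W c
  | pos _ a b c => W a + W b + W c
  | success _ _ a => W a

theorem succSum_mapEdges_le {W W' : ℕ → ℕ} {φ : EdgeLabel → ℕ → ℕ} {nd : Node L V}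
    (h : ∀ ℓ a, nd.succ ℓ = some a → W' (φ ℓ a) ≤ W a) :
    (nd.mapEdges φ).succSum W' ≤ nd.succSum W := by
  cases nd with
  | exit => exact le_rfl
  | root a => exact h .next _ rfl
  | success l r a => exact h .next _ rfl
  | cmp s t a b c =>
    exact add_le_add (add_le_add (h .gt _ rfl) (h .eq _ rfl)) (h .ngeq _ rfl)
  | pos e a b c =>
    exact add_le_add (add_le_add (h .gt _ rfl) (h .geq _ rfl)) (h .ngeq _ rfl)

theorem succSum_mapEdges_lt {W W' : ℕ → ℕ} {φ : EdgeLabel → ℕ → ℕ} {nd : Node L V}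
    (h : ∀ ℓ a, nd.succ ℓ = some a → W' (φ ℓ a) ≤ W a) {ℓ₀ : EdgeLabel} {a₀ : ℕ}
    (h₀ : nd.succ ℓ₀ = some a₀) (hlt : W' (φ ℓ₀ a₀) < W a₀) :
    (nd.mapEdges φ).succSum W' < nd.succSum W := by
  cases nd with
  | exit => cases ℓ₀ <;> simp [succ] at h₀
  | root a => cases ℓ₀ <;> simp [succ] at h₀; subst h₀; exact hlt
  | success l r a => cases ℓ₀ <;> simp [succ] at h₀; subst h₀; exact hlt
  | cmp s t a b c =>
    have h1 := h .gt _ rfl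
    have h2 := h .eq _ rfl
    have h3 := h .ngeq _ rfl
    simp only [mapEdges, succSum]
    cases ℓ₀ <;> simp [succ] at h₀ <;> subst h₀ <;> omega
  | pos e a b c =>
    have h1 := h .gt _ rfl
    have h2 := h .geq _ rfl
    have h3 := h .ngeq _ rfl
    simp only [mapEdges, succSum]
    cases ℓ₀ <;> simp [succ] at h₀ <;> subst h₀ <;> omega

theorem succSum_le {W : ℕ → ℕ} {nd : Node L V} {B : ℕ}
    (h : ∀ ℓ a, nd.succ ℓ = some a → W a ≤ B) : nd.succSum W ≤ 3 * B := by
  cases nd with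
  | exit => exact Nat.zero_le _
  | root a => exact (h .next _ rfl).trans (by omega)
  | success l r a => exact (h .next _ rfl).trans (by omega)
  | cmp s t a b c =>
    have h1 := h .gt _ rfl
    have h2 := h .eq _ rfl
    have h3 := h .ngeq _ rfl
    simp only [succSum]
    omega
  | pos e a b c =>
    have h1 := h .gt _ rfl
    have h2 := h .geq _ rfl
    have h3 := h .ngeq _ rfl
    simp only [succSum]
    omega

theorem le_succSum (W : ℕ → ℕ) {nd : Node L V} {ℓ : EdgeLabel} {a : ℕ}
    (h : nd.succ ℓ = some a) : W a ≤ nd.succSum W := by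
  cases nd <;> cases ℓ <;> simp [succ] at h <;> subst h <;> simp only [succSum] <;> omega

theorem size_mapEdges (φ : EdgeLabel → ℕ → ℕ) (nd : Node L V) :
    (nd.mapEdges φ).size = nd.size := by
  cases nd <;> rfl

/-- The size of the unfolding at a node, where a comparison counts as much as its expansion. -/
def unfold (W : ℕ → ℕ) (nd : Node L V) : ℕ :=
  expansionBound nd.size * (1 + nd.succSum W)

theorem unfold_mapEdges_le {W W' : ℕ → ℕ} {φ : EdgeLabel → ℕ → ℕ} {nd : Node L V}
    (h : ∀ ℓ a, nd.succ ℓ = some a → W' (φ ℓ a) ≤ W a) :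
    (nd.mapEdges φ).unfold W' ≤ nd.unfold W := by
  rw [unfold, unfold, size_mapEdges]
  exact Nat.mul_le_mul_left _ (Nat.add_le_add_left (succSum_mapEdges_le h) 1)

theorem unfold_mapEdges_lt {W W' : ℕ → ℕ} {φ : EdgeLabel → ℕ → ℕ} {nd : Node L V}
    (h : ∀ ℓ a, nd.succ ℓ = some a → W' (φ ℓ a) ≤ W a) {ℓ₀ : EdgeLabel} {a₀ : ℕ}
    (h₀ : nd.succ ℓ₀ = some a₀) (hlt : W' (φ ℓ₀ a₀) < W a₀) :
    (nd.mapEdges φ).unfold W' < nd.unfold W := by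
  rw [unfold, unfold, size_mapEdges]
  exact Nat.mul_lt_mul_of_pos_left (Nat.add_lt_add_left (succSum_mapEdges_lt h h₀ hlt) 1)
    (expansionBound_pos _)

theorem unfold_congr {W W' : ℕ → ℕ} {nd : Node L V}
    (h : ∀ ℓ a, nd.succ ℓ = some a → W' a = W a) : nd.unfold W' = nd.unfold W := by
  refine le_antisymm ?_ ?_
  · simpa [mapEdges_id] using
      unfold_mapEdges_le (φ := fun _ a => a) fun ℓ a ha => (h ℓ a ha).le
  · simpa [mapEdges_id] using
      unfold_mapEdges_le (φ := fun _ a => a) fun ℓ a ha => (h ℓ a ha).ge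

theorem one_add_succSum_le_unfold (W : ℕ → ℕ) (nd : Node L V) : 1 + nd.succSum W ≤ nd.unfold W :=
  Nat.le_mul_of_pos_left _ (expansionBound_pos _)

theorem lt_unfold (W : ℕ → ℕ) {nd : Node L V} {ℓ : EdgeLabel} {a : ℕ}
    (h : nd.succ ℓ = some a) : W a < nd.unfold W := by
  have h1 := le_succSum W h
  have h2 := one_add_succSum_le_unfold W nd
  omega

end Node

/-- `W n` is the size of the unfolding of `D` at the node `n`. -/
def IsUnfoldingSize (D : Diagram L V) (W : ℕ → ℕ) : Prop :=
  ∀ n nd, D n = some nd → W n = nd.unfold W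

/-- The recursion equation is iterated from the zero function. The value at `n` no longer changes
once the number of iterations exceeds the rank of `n`. -/
theorem IsRootedDAG.exists_isUnfoldingSize {D : Diagram L V} (h : IsRootedDAG D) :
    ∃ W, IsUnfoldingSize D W := by
  obtain ⟨ρ, hρ⟩ := h.exists_rank
  let A : ℕ → ℕ → ℕ := fun k => Nat.rec (fun _ => 0)
    (fun _ W n => ((D n).map (Node.unfold W)).getD 0) k
  have hA : ∀ k n nd, D n = some nd → A (k + 1) n = nd.unfold (A k) := by
    intro k n nd hnd
    change ((D n).map (Node.unfold (A k))).getD 0 = _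
    simp [hnd]
  have hst : ∀ k k' n, D n ≠ none → ρ n < k → ρ n < k' → A k n = A k' n := by
    intro k
    induction k with
    | zero => intro k' n _ h0; omega
    | succ k ih =>
      intro k' n hn h1 h2
      obtain ⟨k', rfl⟩ : ∃ j, k' = j + 1 := ⟨k' - 1, by omega⟩
      obtain ⟨nd, hnd⟩ := Option.ne_none_iff_exists'.1 hn
      rw [hA k n nd hnd, hA k' n nd hnd]
      refine Node.unfold_congr fun ℓ a ha => ?_
      have hadj := Diagram.adj_of_succ hnd ha
      have := hρ _ _ hadj
      exact ih k' a (h.edge_closed _ _ hadj) (by omega) (by omega)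
  refine ⟨fun n => A (ρ n + 1) n, fun n nd hnd => ?_⟩
  change A (ρ n + 1) n = _
  rw [hA _ n nd hnd]
  refine Node.unfold_congr fun ℓ a ha => ?_
  have hadj := Diagram.adj_of_succ hnd ha
  have := hρ _ _ hadj
  exact hst (ρ n) (ρ a + 1) a (h.edge_closed _ _ hadj) this (by omega)

/-- Every descendant of a node occurs in its unfolding at least once, and each occurrence counts at
least 1. This bound prevents endless replication. -/
theorem IsUnfoldingSize.ncard_le {D : Diagram L V} {W : ℕ → ℕ} (hW : IsUnfoldingSize D W)
    (h : IsTOD D) {a : ℕ} (ha : D.IsRoot a) : {n | D n ≠ none}.ncard ≤ W a := by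
  obtain ⟨ρ, hρ⟩ := h.isRootedDAG.exists_rank
  have hmem : ∀ n m, D n ≠ none → ReflTransGen D.Adj n m → D m ≠ none := by
    intro n m hn hm
    rcases hm.cases_tail with rfl | ⟨c, -, hc⟩
    · exact hn
    · exact h.edge_closed _ _ hc
  have key : ∀ n, D n ≠ none → {m | ReflTransGen D.Adj n m}.ncard ≤ W n := by
    intro n
    induction hk : ρ n using Nat.strong_induction_on generalizing n with
    | _ k ih =>
      intro hn
      obtain ⟨nd, hnd⟩ := Option.ne_none_iff_exists'.1 hn
      have hcard : ∀ ℓ c, nd.succ ℓ = some c →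
          {m | ReflTransGen D.Adj c m}.ncard ≤ W c := by
        intro ℓ c hc
        have hadj := Diagram.adj_of_succ hnd hc
        exact ih _ (hk ▸ hρ _ _ hadj) c rfl (h.edge_closed _ _ hadj)
      have hfin : ∀ ℓ c, nd.succ ℓ = some c → {m | ReflTransGen D.Adj c m}.Finite := by
        intro ℓ c hc
        exact h.finite.subset fun m hm =>
          hmem c m (h.edge_closed _ _ (Diagram.adj_of_succ hnd hc)) hm
      have hsub : ∀ m, ReflTransGen D.Adj n m →
          m = n ∨ ∃ ℓ c, nd.succ ℓ = some c ∧ ReflTransGen D.Adj c m := by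
        intro m hm
        rcases hm.cases_head with rfl | ⟨c, ⟨ℓ, nd', h1, h2⟩, hc⟩
        · exact .inl rfl
        · obtain rfl := Option.some_inj.1 (h1.symm.trans hnd)
          exact .inr ⟨ℓ, c, h2, hc⟩
      rw [hW n nd hnd]
      refine le_trans ?_ (Node.one_add_succSum_le_unfold W nd)
      have one : ∀ (ℓ : EdgeLabel) (a : ℕ), nd.succ ℓ = some a →
          (∀ ℓ' c, nd.succ ℓ' = some c → c = a) →
          {m | ReflTransGen D.Adj n m}.ncard ≤ 1 + W a := by
        intro ℓ a ha hall
        calc {m | ReflTransGen D.Adj n m}.ncard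
            ≤ ({n} ∪ {m | ReflTransGen D.Adj a m}).ncard := by
              refine Set.ncard_le_ncard ?_ ((Set.finite_singleton n).union (hfin ℓ a ha))
              intro m hm
              rcases hsub m hm with h1 | ⟨ℓ', c, h1, h2⟩
              · exact .inl h1
              · obtain rfl := hall ℓ' c h1
                exact .inr h2
          _ ≤ _ := Set.ncard_union_le _ _
          _ ≤ _ := by
              rw [Set.ncard_singleton]
              exact Nat.add_le_add_left (hcard ℓ a ha) 1
      have three : ∀ (ℓ₁ ℓ₂ ℓ₃ : EdgeLabel) (a b c : ℕ), nd.succ ℓ₁ = some a →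
          nd.succ ℓ₂ = some b → nd.succ ℓ₃ = some c →
          (∀ ℓ' d, nd.succ ℓ' = some d → d = a ∨ d = b ∨ d = c) →
          {m | ReflTransGen D.Adj n m}.ncard ≤ 1 + (W a + W b + W c) := by
        intro ℓ₁ ℓ₂ ℓ₃ a b c ha hb hc hall
        have f1 := hfin _ _ ha
        have f2 := hfin _ _ hb
        have f3 := hfin _ _ hc
        have g1 := hcard _ _ ha
        have g2 := hcard _ _ hb
        have g3 := hcard _ _ hc
        have e1 : {m | ReflTransGen D.Adj n m}.ncard ≤
            ({n} ∪ (({m | ReflTransGen D.Adj a m} ∪ {m | ReflTransGen D.Adj b m}) ∪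
              {m | ReflTransGen D.Adj c m})).ncard := by
          refine Set.ncard_le_ncard ?_ ((Set.finite_singleton n).union ((f1.union f2).union f3))
          intro m hm
          rcases hsub m hm with h1 | ⟨ℓ', d, h1, h2⟩
          · exact .inl h1
          · rcases hall ℓ' d h1 with rfl | rfl | rfl
            · exact .inr (.inl (.inl h2))
            · exact .inr (.inl (.inr h2))
            · exact .inr (.inr h2)
        have e2 := Set.ncard_union_le {n} (({m | ReflTransGen D.Adj a m} ∪
          {m | ReflTransGen D.Adj b m}) ∪ {m | ReflTransGen D.Adj c m})
        have e3 := Set.ncard_union_le ({m | ReflTransGen D.Adj a m} ∪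
          {m | ReflTransGen D.Adj b m}) {m | ReflTransGen D.Adj c m}
        have e4 := Set.ncard_union_le {m | ReflTransGen D.Adj a m} {m | ReflTransGen D.Adj b m}
        rw [Set.ncard_singleton] at e2
        omega
      cases nd with
      | exit =>
        refine (Set.ncard_le_ncard (t := {n}) ?_ (Set.finite_singleton n)).trans (by simp)
        intro m hm
        rcases hsub m hm with h1 | ⟨ℓ', c, h1, h2⟩
        · exact h1
        · cases ℓ' <;> cases h1
      | root a => exact one .next a rfl (fun ℓ' d hd => by cases ℓ' <;> cases hd; rfl)
      | success l r a => exact one .next a rfl (fun ℓ' d hd => by cases ℓ' <;> cases hd; rfl)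
      | cmp s t a b c =>
        exact three .gt .eq .ngeq a b c rfl rfl rfl
          (fun ℓ' d hd => by cases ℓ' <;> cases hd <;> simp)
      | pos e a b c =>
        exact three .gt .geq .ngeq a b c rfl rfl rfl
          (fun ℓ' d hd => by cases ℓ' <;> cases hd <;> simp)
  have hne : D a ≠ none := by
    obtain ⟨c, hc⟩ := ha
    simp [hc]
  refine le_trans (Set.ncard_le_ncard ?_ (h.finite.subset fun m hm => hmem a m hne hm)) (key a hne)
  exact fun m hm => h.reachable_from_root a m ha hm

/-- The size depends only on the descendants of a node, and a node that survives with its edges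
keeps all of them. It thus transfers sizes across the clean-up. -/
theorem IsUnfoldingSize.eq_of_le {D D' : Diagram L V} {W W' : ℕ → ℕ} (hD : IsRootedDAG D)
    (hD' : IsRootedDAG D') (hle : ∀ m nd, D' m = some nd → D m = some nd)
    (hW : IsUnfoldingSize D W) (hW' : IsUnfoldingSize D' W') (n : ℕ) (hn : D' n ≠ none) :
    W' n = W n := by
  obtain ⟨ρ, hρ⟩ := hD.exists_rank
  induction hk : ρ n using Nat.strong_induction_on generalizing n with
  | _ k ih =>
    obtain ⟨nd, hnd⟩ := Option.ne_none_iff_exists'.1 hn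
    rw [hW n nd (hle _ _ hnd), hW' n nd hnd]
    refine Node.unfold_congr fun ℓ a ha => ?_
    exact ih _ (hk ▸ hρ _ _ (Diagram.adj_of_succ (hle _ _ hnd) ha)) a
      (hD'.edge_closed _ _ (Diagram.adj_of_succ hnd ha)) rfl

namespace IsModification

variable {D H : Diagram L V} {n alt : ℕ} {keep : Prop} {N : Set ℕ} {W W' : ℕ → ℕ}

theorem unfoldingSize_le (h : IsModification D H n alt keep N) (hD : IsRootedDAG D)
    (hW : IsUnfoldingSize D W) (hW' : IsUnfoldingSize H W')
    (halt : (∀ c, D.Adj n c → W' c ≤ W c) → W' alt ≤ W n) (m m' : ℕ) (hm : D m ≠ none)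
    (hcor : Corresponds n alt keep m m') : W' m' ≤ W m := by
  obtain ⟨ρ, hρ⟩ := hD.exists_rank
  induction hk : ρ m using Nat.strong_induction_on generalizing m m' with
  | _ k ih =>
    rcases hcor with ⟨rfl, hkeep⟩ | ⟨rfl, rfl⟩
    · obtain ⟨nd, hnd⟩ := Option.ne_none_iff_exists'.1 hm
      obtain ⟨φ, hφ, hcor⟩ := h.old _ nd hnd hkeep
      rw [hW _ _ hnd, hW' _ _ hφ]
      refine Node.unfold_mapEdges_le fun ℓ a ha => ?_
      have hadj := Diagram.adj_of_succ hnd ha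
      exact ih _ (hk ▸ hρ _ _ hadj) a _ (hD.edge_closed _ _ hadj) (hcor _ _ ha) rfl
    · refine halt fun c hc => ?_
      exact ih _ (hk ▸ hρ _ _ hc) c c (hD.edge_closed _ _ hc) (.of_ne (hD.ne_of_adj hc)) rfl

/-- The recursion is strictly monotone in the value at each target, so the drop at one redirected
edge climbs along a path from the root to that edge. -/
theorem unfoldingSize_root_lt (h : IsModification D H n alt keep N) (hD : IsTOD D)
    (hW : IsUnfoldingSize D W) (hW' : IsUnfoldingSize H W')
    (halt : (∀ c, D.Adj n c → W' c ≤ W c) → W' alt < W n) {root : ℕ} (hroot : D.IsRoot root) :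
    W' root < W root := by
  have hD' := hD.isRootedDAG
  have hle := h.unfoldingSize_le hD' hW hW' fun hc => (halt hc).le
  have hlt : W' alt < W n := halt fun c hc =>
    hle c c (hD.edge_closed _ _ hc) (.of_ne (hD'.ne_of_adj hc))
  obtain ⟨n₁, ℓ, nd₁, nd₁', h1, h2, h3, h4⟩ := h.redirected
  have hadj := Diagram.adj_of_succ h1 h2
  have hpath := hD.reachable_from_root root n₁ hroot (by simp [h1])
  clear hroot
  induction hpath using ReflTransGen.head_induction_on with
  | refl =>
    obtain ⟨φ, hφ, hcor⟩ := h.old _ nd₁ h1 (.inl (hD'.ne_of_adj hadj).symm)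
    rw [h3, Option.some_inj] at hφ
    subst hφ
    rw [Node.succ_mapEdges, h2, Option.map_some, Option.some_inj] at h4
    rw [hW _ _ h1, hW' _ _ h3]
    refine Node.unfold_mapEdges_lt (fun ℓ a ha => ?_) h2 (h4 ▸ hlt)
    exact hle a _ (hD.edge_closed _ _ (Diagram.adj_of_succ h1 ha)) (hcor _ _ ha)
  | @head x y hxy hpath ih =>
    -- The path avoids `n`, since `n₁` has an edge to `n`; hence its edges are not redirected.
    have hcyc : ∀ z, ReflTransGen D.Adj z n₁ → z ≠ n := by
      rintro z hz rfl
      exact hD.acyclic _ (TransGen.tail' hz hadj)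
    obtain ⟨ℓ', nd, hnd, hs⟩ := hxy
    obtain ⟨φ, hφ, hcor⟩ := h.old _ nd hnd
      (.inl (hcyc x (hpath.head (Diagram.adj_of_succ hnd hs))))
    rw [hW _ _ hnd, hW' _ _ hφ]
    refine Node.unfold_mapEdges_lt (fun ℓ a ha => ?_) hs ?_
    · exact hle a _ (hD.edge_closed _ _ (Diagram.adj_of_succ hnd ha)) (hcor _ _ ha)
    · rw [(hcor _ _ hs).eq (hcyc y hpath)]
      exact ih

end IsModification

/-! ### Expansions -/

theorem termSize_pos (t : L.Term V) : 0 < termSize t := by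
  cases t <;> simp only [termSize] <;> omega

theorem termSize_arg_lt {k : ℕ} (f : L.Functions k) (ts : Fin k → L.Term V) (i : Fin k) :
    termSize (ts i) < termSize (.func f ts) := by
  have := Finset.single_le_sum (f := fun i => termSize (ts i)) (fun _ _ => Nat.zero_le _)
    (Finset.mem_univ i)
  simp only [termSize]
  omega

theorem arity_lt_termSize {k : ℕ} (f : L.Functions k) (ts : Fin k → L.Term V) :
    k < termSize (.func f ts) := by
  have := Finset.sum_le_sum (s := Finset.univ) fun i _ => Nat.succ_le_of_lt (termSize_pos (ts i))
  simp only [termSize]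
  simp at this
  omega

/-- The nodes of a list are evaluation nodes of size less than `k`, each of which has edges only to
`T` and to nodes that come later in the list. -/
def IsTopological (T : Set ℕ) (k : ℕ) : List (ℕ × Node L V) → Prop
  | [] => True
  | p :: l => (p.2.IsEval ∧ p.2.size < k ∧
      ∀ ℓ c, p.2.succ ℓ = some c → c ∈ T ∨ c ∈ l.map Prod.fst) ∧ IsTopological T k l

theorem IsTopological.append {T : Set ℕ} {k : ℕ} {l l' : List (ℕ × Node L V)}
    (h : IsTopological (T ∪ {c | c ∈ l'.map Prod.fst}) k l) (h' : IsTopological T k l') :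
    IsTopological T k (l ++ l') := by
  induction l with
  | nil => exact h'
  | cons p l ih =>
    obtain ⟨⟨h1, h2, h3⟩, h4⟩ := h
    refine ⟨⟨h1, h2, fun ℓ c hc => ?_⟩, ih h4⟩
    change c ∈ T ∨ c ∈ (l ++ l').map Prod.fst
    rw [List.map_append, List.mem_append]
    rcases h3 ℓ c hc with (h5 | h5) | h5
    · exact .inl h5
    · exact .inr (.inr h5)
    · exact .inr (.inl h5)

theorem isTopological_map {α : Type*} [Preorder α] {T : Set ℕ} {k : ℕ} {F : α → ℕ × Node L V}
    {l : List α} (hl : l.Pairwise (· < ·))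
    (hF : ∀ i ∈ l, (F i).2.IsEval ∧ (F i).2.size < k ∧ ∀ ℓ c, (F i).2.succ ℓ = some c →
      c ∈ T ∨ ∃ j ∈ l, i < j ∧ c = (F j).1) :
    IsTopological T k (l.map F) := by
  induction l with
  | nil => trivial
  | cons i l ih =>
    rw [List.pairwise_cons] at hl
    refine ⟨?_, ih hl.2 ?_⟩
    · obtain ⟨h1, h2, h3⟩ := hF i (by simp)
      refine ⟨h1, h2, fun ℓ c hc => (h3 ℓ c hc).imp_right ?_⟩
      rintro ⟨j, hj, hij, rfl⟩
      rcases List.mem_cons.1 hj with rfl | hj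
      · exact absurd hij (lt_irrefl _)
      · simp only [List.map_map, List.mem_map]
        exact ⟨j, hj, rfl⟩
    · intro i' hi'
      obtain ⟨h1, h2, h3⟩ := hF i' (List.mem_cons_of_mem _ hi')
      refine ⟨h1, h2, fun ℓ c hc => (h3 ℓ c hc).imp_right ?_⟩
      rintro ⟨j, hj, hij, rfl⟩
      rcases List.mem_cons.1 hj with rfl | hj
      · exact absurd (hij.trans (hl.1 i' hi')) (lt_irrefl _)
      · exact ⟨j, hj, hij, rfl⟩

theorem IsTopological.isEval {T : Set ℕ} {k : ℕ} {l : List (ℕ × Node L V)}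
    (h : IsTopological T k l) {p : ℕ × Node L V} (hp : p ∈ l) : p.2.IsEval := by
  induction l with
  | nil => simp at hp
  | cons q l ih =>
    rcases List.mem_cons.1 hp with rfl | hp
    · exact h.1.1
    · exact ih h.2 hp

theorem IsTopological.exists_depth {T : Set ℕ} {k : ℕ} {l : List (ℕ × Node L V)}
    (h : IsTopological T k l) (hnd : (l.map Prod.fst).Nodup) :
    ∃ depth : ℕ → ℕ, (∀ m, depth m ≤ l.length) ∧ ∀ p ∈ l, ∀ ℓ c, p.2.succ ℓ = some c →
      c ∈ T ∨ (c ∈ l.map Prod.fst ∧ depth c < depth p.1) := by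
  induction l with
  | nil => exact ⟨fun _ => 0, by simp, by simp⟩
  | cons q l ih =>
    rw [List.map_cons, List.nodup_cons] at hnd
    obtain ⟨⟨-, -, hq⟩, hl⟩ := h
    obtain ⟨depth, h1, h2⟩ := ih hl hnd.2
    have hne : ∀ c ∈ l.map Prod.fst, c ≠ q.1 := by
      rintro c hc rfl
      exact hnd.1 hc
    -- Depth counts from the end of the list: later entries have at most `l.length`, so the head
    -- gets one more.
    refine ⟨fun m => if m = q.1 then l.length + 1 else depth m, fun m => ?_, fun p hp ℓ c hc => ?_⟩
    · have := h1 m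
      rw [List.length_cons]
      dsimp only
      split_ifs <;> omega
    · rcases List.mem_cons.1 hp with rfl | hp
      · refine (hq ℓ c hc).imp_right fun hcl => ⟨List.mem_cons_of_mem _ hcl, ?_⟩
        have := h1 c
        simp only [hne c hcl, if_true, if_false]
        omega
      · refine (h2 p hp ℓ c hc).imp_right fun hcl => ⟨List.mem_cons_of_mem _ hcl.1, ?_⟩
        simpa only [hne c hcl.1, hne p.1 (List.mem_map_of_mem hp), if_false] using hcl.2

/-- If the targets of an entry are bounded by B ≥ 1, its at most three edges give a size of at most
E(k)(1 + 3B) ≤ 4E(k)B. So each entry, counted from the end of the list, contributes one factor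
4E(k); `hX` ensures that B absorbs the summand 1. -/
theorem IsTopological.unfoldingSize_le {T : Set ℕ} {k X : ℕ} {l : List (ℕ × Node L V)}
    {W : ℕ → ℕ} (h : IsTopological T (k + 1) l) (hW : ∀ p ∈ l, W p.1 = p.2.unfold W)
    (hX : 0 < X) (hT : ∀ c ∈ T, W c ≤ X) :
    ∀ c ∈ l.map Prod.fst, W c ≤ (4 * expansionBound k) ^ l.length * X := by
  induction l with
  | nil => simp
  | cons q l ih =>
    obtain ⟨⟨-, hsize, hq⟩, hl⟩ := h
    have ih := ih hl fun p hp => hW p (List.mem_cons_of_mem _ hp)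
    have hA := expansionBound_pos k
    set B := (4 * expansionBound k) ^ l.length * X with hB
    have hpow : 0 < (4 * expansionBound k) ^ l.length := pow_pos (by omega) _
    have hXB : X ≤ B := Nat.le_mul_of_pos_left _ hpow
    have hB' : (4 * expansionBound k) ^ (q :: l).length * X = expansionBound k * (4 * B) := by
      rw [List.length_cons, pow_succ, hB]
      ring
    rw [hB']
    intro c hc
    rw [List.map_cons, List.mem_cons] at hc
    rcases hc with rfl | hc
    · rw [hW q (by simp), Node.unfold]
      refine Nat.mul_le_mul (expansionBound_mono (by omega)) ?_
      have := Node.succSum_le (nd := q.2) (W := W) (B := B) fun ℓ a ha =>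
        (hq ℓ a ha).elim (fun h => (hT a h).trans hXB) (ih a)
      omega
    · calc W c ≤ B := ih c hc
        _ ≤ 4 * B := by omega
        _ ≤ _ := Nat.le_mul_of_pos_left _ hA

theorem Replaces.eq_of_mem {D H : Diagram L V} {n entry : ℕ} {new : List (ℕ × Node L V)}
    (h : Replaces D H n entry new) {m : ℕ} {nd : Node L V} (hm : (m, nd) ∈ new) :
    H m = some nd :=
  (h.nodes m nd).2 (.inl hm)

/-- `H` arises from `D` by replacing the comparison node `n` by smaller evaluation nodes. -/
structure IsExpansion (D H : Diagram L V) (n entry : ℕ) (new : List (ℕ × Node L V)) : Prop where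
  replaces : Replaces D H n entry new
  exists_node : ∃ nd k, D n = some nd ∧ nd.IsInner ∧ nd.size = k + 1 ∧
    IsTopological {c | D.Adj n c} (k + 1) new ∧ new.length < 3 * (k + 1)
  entry_mem : D.Adj n entry ∨ entry ∈ new.map Prod.fst

namespace IsExpansion

variable {D H : Diagram L V} {n entry : ℕ} {new : List (ℕ × Node L V)}

theorem isModification (h : IsExpansion D H n entry new) (hD : IsTOD D) :
    IsModification D H n entry False {m | m ∈ new.map Prod.fst} where
  inner := by
    obtain ⟨nd, k, hnd, hi, -⟩ := h.exists_node
    exact ⟨nd, hnd, hi⟩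
  fresh := by
    intro m hm
    obtain ⟨p, hp, rfl⟩ := List.mem_map.1 hm
    simpa using h.replaces.fresh p hp
  finite := List.finite_toSet _
  old := by
    rintro m nd hm (hne | hf)
    · refine ⟨fun _ a => if a = n then entry else a,
        (h.replaces.nodes _ _).2 (.inr ⟨hne, nd, hm, rfl⟩), fun ℓ a _ => ?_⟩
      dsimp only
      split_ifs with han
      · exact .inr ⟨han, rfl⟩
      · exact .of_ne han
    · exact hf.elim
  exhaustive := by
    intro m hm
    obtain ⟨nd, hnd⟩ := Option.ne_none_iff_exists'.1 hm
    rcases (h.replaces.nodes _ _).1 hnd with h1 | ⟨h1, nd₀, h2, -⟩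
    · exact .inl (List.mem_map.2 ⟨_, h1, rfl⟩)
    · exact .inr ⟨by simp [h2], .inl h1⟩
  new := by
    obtain ⟨nd, k, -, -, -, htop, -⟩ := h.exists_node
    obtain ⟨depth, -, hdepth⟩ := htop.exists_depth h.replaces.nodup
    refine ⟨depth, fun m hm => ?_⟩
    obtain ⟨p, hp, rfl⟩ := List.mem_map.1 hm
    exact ⟨p.2, h.replaces.eq_of_mem hp, (htop.isEval hp).isInner, fun ℓ c hc =>
      (hdepth p hp ℓ c hc).symm⟩
  alt_mem := h.entry_mem.symm
  redirected := by
    obtain ⟨nd, k, hnd, hi, -⟩ := h.exists_node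
    obtain ⟨root, hroot, -⟩ := hD.root_unique
    -- An inner node is not the root, so the path from the root ends with an edge into `n`; this
    -- edge is redirected.
    rcases (hD.reachable_from_root root n hroot (by simp [hnd])).cases_tail with
      rfl | ⟨n₁, -, hadj⟩
    · obtain ⟨c, hc⟩ := hroot
      rw [hc, Option.some_inj] at hnd
      subst hnd
      exact hi.elim
    · have hne := (hD.isRootedDAG.ne_of_adj hadj).symm
      obtain ⟨ℓ, nd₁, h1, h2⟩ := hadj
      refine ⟨n₁, ℓ, nd₁, _, h1, h2, (h.replaces.nodes _ _).2 (.inr ⟨hne, nd₁, h1, rfl⟩), ?_⟩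
      simp [Node.succ_mapEdges, h2]

/-- One plus the sum over the edges of `n` bounds every child of `n` and serves as X in the estimate
for the list. Strictness comes from the list being shorter than the exponent in `expansionBound`,
the base being at least 4. If no node is new, `entry` is a child of `n` and is smaller anyway. -/
theorem unfoldingSize_entry_lt (h : IsExpansion D H n entry new)
    {W W' : ℕ → ℕ} (hW : IsUnfoldingSize D W) (hW' : IsUnfoldingSize H W')
    (hle : ∀ c, D.Adj n c → W' c ≤ W c) : W' entry < W n := by
  obtain ⟨nd, k, hnd, -, hsize, htop, hlen⟩ := h.exists_node
  have hT : ∀ c, D.Adj n c → W' c < 1 + nd.succSum W := by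
    intro c hc
    obtain ⟨ℓ, nd', h1, h2⟩ := id hc
    obtain rfl := Option.some_inj.1 (h1.symm.trans hnd)
    have := hle c hc
    have := Node.le_succSum W h2
    omega
  rw [hW n nd hnd]
  rcases h.entry_mem with hc | hc
  · exact (hT _ hc).trans_le (Node.one_add_succSum_le_unfold W nd)
  · have hb := htop.unfoldingSize_le (W := W') (X := 1 + nd.succSum W)
      (fun p hp => hW' _ _ (h.replaces.eq_of_mem hp)) (by omega) (fun c hc => (hT c hc).le) entry hc
    refine hb.trans_lt ?_
    rw [Node.unfold, hsize]
    have hA := expansionBound_pos k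
    exact Nat.mul_lt_mul_of_pos_right (Nat.pow_lt_pow_right (by omega) hlen) (by omega)

end IsExpansion

/-! ### Evaluation of nodes -/

section Evaluation

variable {r : L.Term V → L.Term V → Prop} {w : Symbol L → ℕ} {σ : Subst L V} {D : Diagram L V}
  {n a b c : ℕ} {s t : L.Term V} {e : LinExpr V}

theorem successFrom_cmp_gt (h : D n = some (.cmp s t a b c)) (hr : r (σ.app s) (σ.app t)) :
    successFrom r w D σ n = successFrom r w D σ a :=
  successFrom_eq_of_isEval h trivial (by simp [Node.evalLabel, hr, Node.succ])

theorem successFrom_cmp_eq (h : D n = some (.cmp s t a b c)) (hr : ¬ r (σ.app s) (σ.app t))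
    (heq : σ.app s = σ.app t) : successFrom r w D σ n = successFrom r w D σ b :=
  successFrom_eq_of_isEval h trivial (by
    rw [Node.evalLabel, if_neg hr, if_pos heq]; rfl)

theorem successFrom_cmp_ngeq (h : D n = some (.cmp s t a b c)) (hr : ¬ r (σ.app s) (σ.app t))
    (heq : σ.app s ≠ σ.app t) : successFrom r w D σ n = successFrom r w D σ c :=
  successFrom_eq_of_isEval h trivial (by
    rw [Node.evalLabel, if_neg hr, if_neg heq]; rfl)

theorem successFrom_cmp_not_gt (h : D n = some (.cmp s t a b b))
    (hr : ¬ r (σ.app s) (σ.app t)) : successFrom r w D σ n = successFrom r w D σ b := by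
  by_cases heq : σ.app s = σ.app t
  · exact successFrom_cmp_eq h hr heq
  · exact successFrom_cmp_ngeq h hr heq

theorem successFrom_cmp_geq (h : D n = some (.cmp s t a a c))
    (hr : σ.app s = σ.app t ∨ r (σ.app s) (σ.app t)) :
    successFrom r w D σ n = successFrom r w D σ a := by
  by_cases hr' : r (σ.app s) (σ.app t)
  · exact successFrom_cmp_gt h hr'
  · exact successFrom_cmp_eq h hr' (hr.resolve_right hr')

theorem successFrom_pos_gt (h : D n = some (.pos e a b c)) (hr : LinPos w (σ.lin w e)) :
    successFrom r w D σ n = successFrom r w D σ a :=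
  successFrom_eq_of_isEval h trivial (by simp [Node.evalLabel, hr, Node.succ])

theorem successFrom_pos_geq (h : D n = some (.pos e a b c)) (hr : ¬ LinPos w (σ.lin w e))
    (hr' : LinNonneg w (σ.lin w e)) : successFrom r w D σ n = successFrom r w D σ b :=
  successFrom_eq_of_isEval h trivial (by
    rw [Node.evalLabel, if_neg hr, if_pos hr']; rfl)

theorem successFrom_pos_ngeq (h : D n = some (.pos e a b c)) (hr : ¬ LinPos w (σ.lin w e))
    (hr' : ¬ LinNonneg w (σ.lin w e)) : successFrom r w D σ n = successFrom r w D σ c :=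
  successFrom_eq_of_isEval h trivial (by
    rw [Node.evalLabel, if_neg hr, if_neg hr']; rfl)

theorem FollowedEdge.cmp_cases {m : ℕ} (h : FollowedEdge r w D σ n m)
    (hn : D n = some (.cmp s t a b c)) :
    (r (σ.app s) (σ.app t) ∧ m = a) ∨
      (¬ r (σ.app s) (σ.app t) ∧ σ.app s = σ.app t ∧ m = b) ∨
      (¬ r (σ.app s) (σ.app t) ∧ σ.app s ≠ σ.app t ∧ m = c) := by
  obtain ⟨nd, h1, h2⟩ := h
  obtain rfl := Option.some_inj.1 (hn.symm.trans h1)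
  by_cases hr : r (σ.app s) (σ.app t)
  · rw [Node.evalLabel, if_pos hr] at h2
    exact .inl ⟨hr, (Option.some_inj.1 h2).symm⟩
  · by_cases heq : σ.app s = σ.app t
    · rw [Node.evalLabel, if_neg hr, if_pos heq] at h2
      exact .inr (.inl ⟨hr, heq, (Option.some_inj.1 h2).symm⟩)
    · rw [Node.evalLabel, if_neg hr, if_neg heq] at h2
      exact .inr (.inr ⟨hr, heq, (Option.some_inj.1 h2).symm⟩)

end Evaluation

/-- Collapses a stretch of a column in which each node hands the walk on to the next one. -/
theorem Fin.eq_of_chain {α : Type*} {k : ℕ} {F : Fin (k + 1) → α} {a b : Fin (k + 1)} (hab : a ≤ b)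
    (h : ∀ j : Fin k, a ≤ j.castSucc → j.castSucc < b → F j.castSucc = F j.succ) : F a = F b := by
  induction b using Fin.induction with
  | zero => rw [Fin.le_zero_iff.1 hab]
  | succ i ih =>
    rcases hab.eq_or_lt with rfl | hlt
    · rfl
    · have hle : a ≤ i.castSucc := Fin.le_castSucc_iff.2 hlt
      rw [ih hle fun j h1 h2 => h j h1 (h2.trans Fin.castSucc_lt_succ),
        h i hle Fin.castSucc_lt_succ]

theorem Fin.exists_first {k : ℕ} {P : Fin k → Prop} (h : ∃ i, P i) :
    ∃ i, P i ∧ ∀ j < i, ¬ P j := by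
  obtain ⟨i, hi, hmin⟩ := WellFounded.has_min (wellFounded_lt (α := Fin k)) {i | P i} h
  exact ⟨i, hi, fun j hj hP => hmin j hP hj⟩

/-! ### Orders -/

theorem Subst.app_func (σ : Subst L V) {k : ℕ} (f : L.Functions k) (ts : Fin k → L.Term V) :
    σ.app (.func f ts) = .func f fun i => σ.app (ts i) :=
  rfl

theorem symbol_eq_of_func_eq {k m : ℕ} {f : L.Functions k} {g : L.Functions m}
    {ss : Fin k → L.Term V} {ts : Fin m → L.Term V}
    (h : FirstOrder.Language.Term.func f ss = .func g ts) :
    (⟨k, f⟩ : Symbol L) = ⟨m, g⟩ := by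
  cases h
  rfl

theorem func_ne_arg {k : ℕ} (f : L.Functions k) (ts : Fin k → L.Term V) (i : Fin k) :
    ts i ≠ .func f ts := fun h => by
  have := termSize_arg_lt f ts i
  rw [h] at this
  exact lt_irrefl _ this

section Orders

variable {prec : Symbol L → Symbol L → Prop} {k m : ℕ} {f : L.Functions k} {g : L.Functions m}
  {ss : Fin k → L.Term V} {ts : Fin m → L.Term V} {s t : L.Term V}

/-- For the lexicographic rule: before the deciding index the arguments agree and (L3) applies, at
the index (L3) applies to the strict comparison, and beyond it the claim is a premise of the rule.
This special case of transitivity spares the general one. -/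
theorem LPO.arg (h : LPO prec s (.func g ts)) (j : Fin m) : LPO prec s (ts j) := by
  generalize hu : FirstOrder.Language.Term.func g ts = u at h
  induction h with
  | @args n f ss ts' i heq hi hgt ih1 ih2 =>
    cases hu
    rcases lt_trichotomy j i with hj | rfl | hj
    · rw [← heq j hj]
      exact .sub_eq j
    · exact .sub_gt j hi
    · exact hgt j hj
  | symbol _ hall _ =>
    cases hu
    exact hall j
  | sub_eq i =>
    refine .sub_gt i ?_
    rw [← hu]
    exact .sub_eq j
  | sub_gt i _ ih => exact .sub_gt i (ih hu)

/-- The right-hand term stays general, so that the case split meets no equation between two argument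
tuples. -/
theorem LPO.func_iff : LPO prec (.func f ss) t ↔
    (∃ ts i, t = .func f ts ∧ (∀ j, j < i → ss j = ts j) ∧ LPO prec (ss i) (ts i) ∧
      ∀ j, i < j → LPO prec (.func f ss) (ts j)) ∨
    (∃ (m : ℕ) (g : L.Functions m) (ts : Fin m → L.Term V), t = .func g ts ∧
      prec ⟨k, f⟩ ⟨m, g⟩ ∧ ∀ i, LPO prec (.func f ss) (ts i)) ∨
    ∃ i, ss i = t ∨ LPO prec (ss i) t := by
  constructor
  · intro h
    cases h with
    | args i h1 h2 h3 => exact .inl ⟨_, i, rfl, h1, h2, h3⟩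
    | symbol h1 h2 => exact .inr (.inl ⟨_, _, _, rfl, h1, h2⟩)
    | sub_eq i => exact .inr (.inr ⟨i, .inl rfl⟩)
    | sub_gt i h => exact .inr (.inr ⟨i, .inr h⟩)
  · rintro (⟨ts, i, rfl, h1, h2, h3⟩ | ⟨m, g, ts, rfl, h1, h2⟩ | ⟨i, rfl | h⟩)
    · exact .args i h1 h2 h3
    · exact .symbol h1 h2
    · exact .sub_eq i
    · exact .sub_gt i h

theorem KBO.func_iff {w : Symbol L → ℕ} : KBO prec w (.func f ss) t ↔
    LinPos w (weight w (.func f ss) - weight w t) ∨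
    (LinNonneg w (weight w (.func f ss) - weight w t) ∧
      ((∃ (m : ℕ) (g : L.Functions m) (ts : Fin m → L.Term V), t = .func g ts ∧
        prec ⟨k, f⟩ ⟨m, g⟩) ∨
      ∃ ts i, t = .func f ts ∧ KBO prec w (ss i) (ts i) ∧ ∀ j, j < i → ss j = ts j)) := by
  constructor
  · intro h
    cases h with
    | pos h => exact .inl h
    | symbol h1 h2 => exact .inr ⟨h1, .inl ⟨_, _, _, rfl, h2⟩⟩
    | args i h1 h2 h3 => exact .inr ⟨h1, .inr ⟨_, i, rfl, h2, h3⟩⟩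
  · rintro (h | ⟨h, ⟨m, g, ts, rfl, h1⟩ | ⟨ts, i, rfl, h1, h2⟩⟩)
    · exact .pos h
    · exact .symbol h h1
    · exact .args i h h1 h2

/-- The critical case is (L3): an argument cannot equal the whole term for reasons of size, and if
it were greater, `LPO.arg` would make it greater than itself. -/
theorem LPO.irrefl [IsStrictTotalOrder (Symbol L) prec] (t : L.Term V) : ¬ LPO prec t t := by
  induction t with
  | var y => intro h; cases h
  | func f ts ih =>
    intro h
    rcases LPO.func_iff.1 h with ⟨ts', i, heq, -, hi, -⟩ | ⟨m, g, ts', heq, hp, -⟩ | ⟨i, hi | hi⟩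
    · cases heq
      exact ih i hi
    · rw [symbol_eq_of_func_eq heq] at hp
      exact irrefl_of prec _ hp
    · exact func_ne_arg f ts i hi
    · exact ih i (hi.arg i)

theorem LPO.iff_of_prec (h : prec ⟨k, f⟩ ⟨m, g⟩) :
    LPO prec (.func f ss) (.func g ts) ↔ ∀ i, LPO prec (.func f ss) (ts i) :=
  ⟨fun h => h.arg, .symbol h⟩

/-- This is the left column of the expansion: whichever rule was applied, `LPO.arg` recovers the
premises of (L1). -/
theorem LPO.iff_of_arg_gt {ts : Fin k → L.Term V} {i : Fin k} (heq : ∀ j < i, ss j = ts j)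
    (h : LPO prec (ss i) (ts i)) :
    LPO prec (.func f ss) (.func f ts) ↔ ∀ j, i < j → LPO prec (.func f ss) (ts j) :=
  ⟨fun h j _ => h.arg j, .args i heq h⟩

variable [IsStrictTotalOrder (Symbol L) prec]

/-- Hence the `=`-edge of a comparison of different symbols is never followed, and the expansions
may ignore its target. -/
theorem func_ne_of_prec (h : prec ⟨k, f⟩ ⟨m, g⟩) :
    FirstOrder.Language.Term.func f ss ≠ .func g ts := fun heq => by
  rw [symbol_eq_of_func_eq heq] at h
  exact irrefl_of prec _ h

theorem LPO.iff_of_prec_swap (h : prec ⟨m, g⟩ ⟨k, f⟩) :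
    LPO prec (.func f ss) (.func g ts) ↔ ∃ i, ss i = .func g ts ∨ LPO prec (ss i) (.func g ts) := by
  rw [LPO.func_iff]
  refine ⟨?_, fun h => .inr (.inr h)⟩
  rintro (⟨ts', i, heq, -⟩ | ⟨m', g', ts', heq, hp, -⟩ | h')
  · exact absurd heq (func_ne_of_prec h)
  · rw [← symbol_eq_of_func_eq heq] at hp
    exact absurd hp (asymm_of prec h)
  · exact h'

/-- This is the right column of the expansion. (L1) fails at every index, (L2) by irreflexivity of
the precedence. In (L3), an argument that is at least the whole right side exceeds all its arguments
by `LPO.arg`, in particular the one in its own position, which is impossible up to position `i`. -/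
theorem LPO.iff_of_arg_not_ge {ts : Fin k → L.Term V} {i : Fin k} (heq : ∀ j < i, ss j = ts j)
    (h : ¬ LPO prec (ss i) (ts i)) (hne : ss i ≠ ts i) :
    LPO prec (.func f ss) (.func f ts) ↔
      ∃ j, i < j ∧ (ss j = .func f ts ∨ LPO prec (ss j) (.func f ts)) := by
  rw [LPO.func_iff]
  constructor
  · rintro (⟨ts', i', heq', hlt, hi', -⟩ | ⟨m', g', ts', heq', hp, -⟩ | ⟨j, hj⟩)
    · cases heq'
      rcases lt_trichotomy i' i with hlt' | rfl | hlt'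
      · rw [heq i' hlt'] at hi'
        exact absurd hi' (LPO.irrefl _)
      · exact absurd hi' h
      · exact absurd (hlt i hlt') hne
    · rw [symbol_eq_of_func_eq heq'] at hp
      exact absurd hp (irrefl_of prec _)
    · have harg : ∀ l, LPO prec (ss j) (ts l) := by
        intro l
        rcases hj with hj | hj
        · rw [hj]
          exact .sub_eq l
        · exact hj.arg l
      rcases lt_trichotomy j i with hlt' | rfl | hlt'
      · have := harg j
        rw [heq j hlt'] at this
        exact absurd this (LPO.irrefl _)
      · exact absurd (harg j) h
      · exact ⟨j, hlt', hj⟩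
  · rintro ⟨j, -, hj⟩
    exact .inr (.inr ⟨j, hj⟩)

end Orders

/-! ### Weights -/

theorem Subst.lin_zero (w : Symbol L → ℕ) (σ : Subst L V) : σ.lin w 0 = 0 := by
  simp [Subst.lin]

theorem Subst.lin_add (w : Symbol L → ℕ) (σ : Subst L V) (e e' : LinExpr V) :
    σ.lin w (e + e') = σ.lin w e + σ.lin w e' := by
  classical
  have h1 : (e + e').2.sum (fun y a => a • weight w (σ.toFun y)) =
      e.2.sum (fun y a => a • weight w (σ.toFun y)) +
        e'.2.sum (fun y a => a • weight w (σ.toFun y)) :=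
    Finsupp.sum_add_index' (fun _ => zero_smul _ _) fun _ _ _ => add_smul _ _ _
  rw [Subst.lin, Subst.lin, Subst.lin, h1]
  have h2 : (((e + e').1, 0) : LinExpr V) = (e.1, 0) + (e'.1, 0) := by simp
  rw [h2]
  abel

/-- Application of a substitution to linear expressions, as a homomorphism. -/
noncomputable def Subst.linHom (w : Symbol L → ℕ) (σ : Subst L V) : LinExpr V →+ LinExpr V where
  toFun := σ.lin w
  map_zero' := σ.lin_zero w
  map_add' := σ.lin_add w

theorem weight_app (w : Symbol L → ℕ) (σ : Subst L V) (t : L.Term V) :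
    weight w (σ.app t) = σ.lin w (weight w t) := by
  induction t with
  | var y => simp [weight, Subst.lin, Subst.app]
  | @func l f ts ih =>
    rw [Subst.app_func, weight, weight]
    change _ = σ.linHom w _
    rw [map_add, map_sum]
    have h1 : σ.linHom w ((w ⟨l, f⟩ : ℤ), 0) = ((w ⟨l, f⟩ : ℤ), 0) := by
      change σ.lin w _ = _
      simp [Subst.lin]
    rw [h1]
    exact congrArg _ (Finset.sum_congr rfl fun i _ => ih i)

/-- Thus the positivity check under `σ` tests exactly the weight condition of KBO for the instances.
-/
theorem lin_weight_sub (w : Symbol L → ℕ) (σ : Subst L V) (s t : L.Term V) :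
    σ.lin w (weight w s - weight w t) = weight w (σ.app s) - weight w (σ.app t) := by
  rw [weight_app, weight_app]
  exact map_sub (σ.linHom w) _ _

theorem LinPos.linNonneg {w : Symbol L → ℕ} {e : LinExpr V} (h : LinPos w e) : LinNonneg w e :=
  fun σ hσ => (h σ hσ).le

theorem linNonneg_zero (w : Symbol L → ℕ) : LinNonneg w (0 : LinExpr V) := fun σ _ => by
  rw [Subst.lin_zero]
  rfl

/-! ### The expansions of comparison nodes -/

section Names

variable {k : ℕ} {T : Set ℕ} {c : Fin (k + 1) → ℕ}

/-- A column of `k` nodes carries `k + 1` names; the last one is the old node in which the column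
ends. -/
theorem name_succ_cases (h : c (Fin.last k) ∈ T) (i : Fin k) :
    c i.succ ∈ T ∨ ∃ j : Fin k, i < j ∧ c i.succ = c j.castSucc := by
  rcases eq_or_ne i.succ (Fin.last k) with h1 | h1
  · exact .inl (h1 ▸ h)
  · refine .inr ⟨i.succ.castPred h1, ?_, by rw [Fin.castSucc_castPred]⟩
    rw [Fin.lt_def]
    simp

theorem name_zero_cases (h : c (Fin.last k) ∈ T) :
    c 0 ∈ T ∨ ∃ j : Fin k, c 0 = c j.castSucc := by
  rcases eq_or_ne 0 (Fin.last k) with h1 | h1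
  · exact .inl (h1 ▸ h)
  · exact .inr ⟨Fin.castPred 0 h1, by rw [Fin.castSucc_castPred]⟩

/-- The outer columns of the LPO expansion lack row 0, but a walk enters them only below some row
`i` of the middle one. -/
theorem mem_tail_finRange {i j : Fin k} (h : i < j) : j ∈ (List.finRange k).tail := by
  cases k with
  | zero => exact i.elim0
  | succ k =>
    rw [List.finRange_succ, List.tail_cons, List.mem_map]
    have hj : j ≠ 0 := (Fin.zero_le i |>.trans_lt h).ne'
    exact ⟨j.pred hj, List.mem_finRange _, Fin.succ_pred j hj⟩

end Names

section Lists

variable {k N : ℕ} {T : Set ℕ} {c : Fin (k + 1) → ℕ}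

theorem isTopological_ofFn {F : Fin k → Node L V} (hlast : c (Fin.last k) ∈ T)
    (hF : ∀ i, (F i).IsEval ∧ (F i).size < N ∧
      ∀ ℓ a, (F i).succ ℓ = some a → a ∈ T ∨ a = c i.succ) :
    IsTopological T N (List.ofFn fun i : Fin k => (c i.castSucc, F i)) := by
  rw [List.ofFn_eq_map]
  refine isTopological_map (List.pairwise_lt_finRange k) fun i _ => ?_
  obtain ⟨h1, h2, h3⟩ := hF i
  refine ⟨h1, h2, fun ℓ a ha => ?_⟩
  rcases h3 ℓ a ha with h | rfl
  · exact .inl h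
  · refine (name_succ_cases hlast i).imp_right ?_
    rintro ⟨j, hij, hj⟩
    exact ⟨j, List.mem_finRange j, hij, hj⟩

theorem isTopological_map_tail {F : Fin k → Node L V} (hlast : c (Fin.last k) ∈ T)
    (hF : ∀ i, (F i).IsEval ∧ (F i).size < N ∧
      ∀ ℓ a, (F i).succ ℓ = some a → a ∈ T ∨ a = c i.succ) :
    IsTopological T N ((List.finRange k).tail.map fun i : Fin k => (c i.castSucc, F i)) := by
  refine isTopological_map (List.pairwise_lt_finRange k).tail fun i _ => ?_
  obtain ⟨h1, h2, h3⟩ := hF i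
  refine ⟨h1, h2, fun ℓ a ha => ?_⟩
  rcases h3 ℓ a ha with h | rfl
  · exact .inl h
  · refine (name_succ_cases hlast i).imp_right ?_
    rintro ⟨j, hij, hj⟩
    exact ⟨j, mem_tail_finRange hij, hij, hj⟩

theorem Node.cmp_spec {s t : L.Term V} {a b c d : ℕ} (hs : termSize s + termSize t < N)
    (ha : a ∈ T ∨ a = d) (hb : b ∈ T ∨ b = d) (hc : c ∈ T ∨ c = d) :
    (Node.cmp s t a b c).IsEval ∧ (Node.cmp s t a b c).size < N ∧
      ∀ ℓ m, (Node.cmp s t a b c).succ ℓ = some m → m ∈ T ∨ m = d := by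
  refine ⟨trivial, hs, fun ℓ m hm => ?_⟩
  cases ℓ <;> cases hm <;> assumption

end Lists

section Changes

variable {D H : Diagram L V} {prec : Symbol L → Symbol L → Prop} {w : Symbol L → ℕ}

theorem IsExpansion.of_cmp {n entry n₁ n₂ n₃ : ℕ} {s t : L.Term V} {new : List (ℕ × Node L V)}
    (h : Replaces D H n entry new) (hn : D n = some (.cmp s t n₁ n₂ n₃))
    (htop : IsTopological {c | c = n₁ ∨ c = n₂ ∨ c = n₃} (termSize s + termSize t) new)
    (hlen : new.length < 3 * (termSize s + termSize t))
    (hentry : (entry = n₁ ∨ entry = n₂ ∨ entry = n₃) ∨ entry ∈ new.map Prod.fst) :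
    IsExpansion D H n entry new := by
  have hT : ∀ c, D.Adj n c ↔ c = n₁ ∨ c = n₂ ∨ c = n₃ := by
    intro c
    constructor
    · rintro ⟨ℓ, nd, h1, h2⟩
      obtain rfl := Option.some_inj.1 (hn.symm.trans h1)
      cases ℓ <;> cases h2 <;> simp
    · rintro (rfl | rfl | rfl)
      · exact ⟨.gt, _, hn, rfl⟩
      · exact ⟨.eq, _, hn, rfl⟩
      · exact ⟨.ngeq, _, hn, rfl⟩
  obtain ⟨k, hk⟩ : ∃ k, termSize s + termSize t = k + 1 :=
    ⟨termSize s + termSize t - 1, by have := termSize_pos s; omega⟩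
  rw [hk] at htop hlen
  refine ⟨h, ⟨_, k, hn, trivial, hk, ?_, hlen⟩, ?_⟩
  · simpa only [hT] using htop
  · rwa [hT]

/-- The order properties of the precedence are assumed only in the clause about evaluation, so the
structural part serves termination without them. -/
theorem KBOChange.exists_isExpansion (h : KBOChange prec w D H) :
    ∃ n entry new, IsExpansion D H n entry new ∧
      (IsStrictTotalOrder (Symbol L) prec → ∀ σ m, FollowedEdge (KBO prec w) w D σ n m →
        successFrom (KBO prec w) w H σ entry = successFrom (KBO prec w) w H σ m) := by
  cases h with
  | @gt k m f g ss ts n n₁ n₂ n₃ p hn hp hrep =>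
    refine ⟨n, p, _, .of_cmp hrep hn ⟨⟨trivial, ?_, ?_⟩, trivial⟩ ?_ (.inr (by simp)), ?_⟩
    · have := termSize_pos (FirstOrder.Language.Term.func f ss)
      simp only [Node.size]
      omega
    · intro ℓ c hc
      cases ℓ <;> cases hc <;> simp
    · have := termSize_pos (FirstOrder.Language.Term.func f ss)
      simp only [List.length_singleton]
      omega
    · intro _ σ c hc
      have hH := hrep.eq_of_mem (List.mem_singleton.2 rfl)
      have hiff : KBO prec w (σ.app (.func f ss)) (σ.app (.func g ts)) ↔
          LinNonneg w (σ.lin w (weight w (.func f ss) - weight w (.func g ts))) := by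
        rw [lin_weight_sub, Subst.app_func, Subst.app_func, KBO.func_iff]
        constructor
        · rintro (h | h)
          · exact h.linNonneg
          · exact h.1
        · exact fun h => .inr ⟨h, .inl ⟨_, _, _, rfl, hp⟩⟩
      have hne : σ.app (.func f ss) ≠ σ.app (.func g ts) := func_ne_of_prec hp
      rcases hc.cmp_cases hn with ⟨h1, rfl⟩ | ⟨-, h1, -⟩ | ⟨h1, -, rfl⟩
      · rw [hiff] at h1
        by_cases h2 : LinPos w (σ.lin w (weight w (.func f ss) - weight w (.func g ts)))
        · exact successFrom_pos_gt hH h2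
        · exact successFrom_pos_geq hH h2 h1
      · exact absurd h1 hne
      · rw [hiff] at h1
        exact successFrom_pos_ngeq hH (fun h2 => h1 h2.linNonneg) h1
  | @eq k f ss ts n n₁ n₂ n₃ p c hn hlast hrep =>
    have hsize := arity_lt_termSize f ss
    have hpos := termSize_pos (FirstOrder.Language.Term.func f ss)
    refine ⟨n, p, _, .of_cmp hrep hn ⟨⟨trivial, ?_, ?_⟩, ?_⟩ ?_ (.inr (by simp)), ?_⟩
    · simp only [Node.size]
      omega
    · intro ℓ a ha
      have hzero := name_zero_cases (T := {c | c = n₁ ∨ c = n₂ ∨ c = n₃}) (c := c)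
        (.inr (.inl hlast))
      cases ℓ <;> cases ha
      · simp
      · refine hzero.imp_right ?_
        rintro ⟨j, hj⟩
        rw [hj]
        simp only [List.map_ofFn, List.mem_ofFn]
        exact ⟨j, rfl⟩
      · simp
    · refine isTopological_ofFn (.inr (.inl hlast)) fun i =>
        Node.cmp_spec ?_ (by simp) (by simp) (by simp)
      have := termSize_arg_lt f ss i
      have := termSize_arg_lt f ts i
      omega
    · simp only [List.length_cons, List.length_ofFn]
      omega
    · intro _ σ a ha
      have hH := hrep.eq_of_mem (List.mem_cons_self)
      have hc : ∀ i : Fin k, H (c i.castSucc) = some (.cmp (ss i) (ts i) n₁ (c i.succ) n₃) :=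
        fun i => hrep.eq_of_mem (List.mem_cons_of_mem _ (List.mem_ofFn.2 ⟨i, rfl⟩))
      have happ : σ.app (.func f ss) = σ.app (.func f ts) ↔
          ∀ i, σ.app (ss i) = σ.app (ts i) := by
        rw [Subst.app_func, Subst.app_func]
        simp [funext_iff]
      have hiff : KBO prec w (σ.app (.func f ss)) (σ.app (.func f ts)) ↔
          LinPos w (σ.lin w (weight w (.func f ss) - weight w (.func f ts))) ∨
          (LinNonneg w (σ.lin w (weight w (.func f ss) - weight w (.func f ts))) ∧
            ∃ i, KBO prec w (σ.app (ss i)) (σ.app (ts i)) ∧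
              ∀ j, j < i → σ.app (ss j) = σ.app (ts j)) := by
        rw [lin_weight_sub, Subst.app_func, Subst.app_func, KBO.func_iff]
        refine or_congr_right (and_congr_right fun _ => ?_)
        constructor
        · rintro (⟨m, g, ts', heq, hp⟩ | ⟨ts', i, heq, h1, h2⟩)
          · rw [symbol_eq_of_func_eq heq] at hp
            exact absurd hp (irrefl_of prec _)
          · cases heq
            exact ⟨i, h1, h2⟩
        · rintro ⟨i, h1, h2⟩
          exact .inr ⟨_, i, rfl, h1, h2⟩
      -- Equal instances have weight difference 0, so they do not leave the check along `≱`.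
      have hnonneg : σ.app (.func f ss) = σ.app (.func f ts) →
          LinNonneg w (σ.lin w (weight w (.func f ss) - weight w (.func f ts))) := by
        intro heq
        rw [lin_weight_sub, heq, sub_self]
        exact linNonneg_zero w
      have hcases := ha.cmp_cases hn
      -- Irreflexivity of KBO is not needed: the traversal tests `≻` before equality, and the case
      -- distinction does the same.
      by_cases h1 : LinPos w (σ.lin w (weight w (.func f ss) - weight w (.func f ts)))
      · have hgt := hiff.2 (.inl h1)
        rcases hcases with ⟨-, rfl⟩ | ⟨h, -⟩ | ⟨h, -⟩
        · exact successFrom_pos_gt hH h1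
        · exact absurd hgt h
        · exact absurd hgt h
      by_cases h2 : LinNonneg w (σ.lin w (weight w (.func f ss) - weight w (.func f ts)))
      · rw [successFrom_pos_geq hH h1 h2]
        -- The first such `i` is the position at which the walk leaves the chain of `=`-edges.
        by_cases h3 : ∃ i, KBO prec w (σ.app (ss i)) (σ.app (ts i)) ∨
            σ.app (ss i) ≠ σ.app (ts i)
        · obtain ⟨i, hi, hfirst⟩ := Fin.exists_first h3
          push Not at hfirst
          rw [Fin.eq_of_chain (F := fun i => successFrom (KBO prec w) w H σ (c i))
            (Fin.zero_le i.castSucc) fun j _ hj => successFrom_cmp_eq (hc j)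
              (hfirst j hj).1 (hfirst j hj).2]
          by_cases h4 : KBO prec w (σ.app (ss i)) (σ.app (ts i))
          · have hgt := hiff.2 (.inr ⟨h2, i, h4, fun j hj => (hfirst j hj).2⟩)
            rcases hcases with ⟨-, rfl⟩ | ⟨h, -⟩ | ⟨h, -⟩
            · exact successFrom_cmp_gt (hc i) h4
            · exact absurd hgt h
            · exact absurd hgt h
          · have h5 := hi.resolve_left h4
            rcases hcases with ⟨h, -⟩ | ⟨-, h, -⟩ | ⟨-, -, rfl⟩
            · obtain ⟨-, i', h6, h7⟩ := (hiff.1 h).resolve_left h1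
              rcases lt_trichotomy i' i with hlt | rfl | hlt
              · exact absurd h6 (hfirst i' hlt).1
              · exact absurd h6 h4
              · exact absurd (h7 i hlt) h5
            · exact absurd (happ.1 h i) h5
            · exact successFrom_cmp_ngeq (hc i) h4 h5
        · push Not at h3
          rw [Fin.eq_of_chain (F := fun i => successFrom (KBO prec w) w H σ (c i))
            (Fin.zero_le (Fin.last k)) fun j _ _ => successFrom_cmp_eq (hc j) (h3 j).1 (h3 j).2]
          rcases hcases with ⟨h, -⟩ | ⟨-, -, rfl⟩ | ⟨-, h, -⟩
          · obtain ⟨-, i, h6, -⟩ := (hiff.1 h).resolve_left h1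
            exact absurd h6 (h3 i).1
          · rw [hlast]
          · exact absurd (happ.2 fun i => (h3 i).2) h
      · rcases hcases with ⟨h, -⟩ | ⟨-, h, -⟩ | ⟨-, -, rfl⟩
        · exact absurd ((hiff.1 h).resolve_left h1).1 h2
        · exact absurd (hnonneg h) h2
        · exact successFrom_pos_ngeq hH h1 h2
  | @lt k m f g ss ts n n₁ n₂ n₃ p hn hp hrep =>
    refine ⟨n, p, _, .of_cmp hrep hn ⟨⟨trivial, ?_, ?_⟩, trivial⟩ ?_ (.inr (by simp)), ?_⟩
    · have := termSize_pos (FirstOrder.Language.Term.func f ss)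
      simp only [Node.size]
      omega
    · intro ℓ c hc
      cases ℓ <;> cases hc <;> simp
    · have := termSize_pos (FirstOrder.Language.Term.func f ss)
      simp only [List.length_singleton]
      omega
    · intro _ σ c hc
      have hH := hrep.eq_of_mem (List.mem_singleton.2 rfl)
      have hiff : KBO prec w (σ.app (.func f ss)) (σ.app (.func g ts)) ↔
          LinPos w (σ.lin w (weight w (.func f ss) - weight w (.func g ts))) := by
        rw [lin_weight_sub, Subst.app_func, Subst.app_func, KBO.func_iff]
        refine ⟨?_, .inl⟩
        rintro (h | ⟨-, ⟨m', g', ts', heq, hp'⟩ | ⟨ts', i, heq, -⟩⟩)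
        · exact h
        · rw [← symbol_eq_of_func_eq heq] at hp'
          exact absurd hp' (asymm_of prec hp)
        · exact absurd heq (func_ne_of_prec hp)
      have hne : σ.app (.func f ss) ≠ σ.app (.func g ts) := (func_ne_of_prec hp).symm
      rcases hc.cmp_cases hn with ⟨h1, rfl⟩ | ⟨-, h1, -⟩ | ⟨h1, -, rfl⟩
      · exact successFrom_pos_gt hH (hiff.1 h1)
      · exact absurd h1 hne
      · rw [hiff] at h1
        by_cases h2 : LinNonneg w (σ.lin w (weight w (.func f ss) - weight w (.func g ts)))
        · exact successFrom_pos_geq hH h1 h2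
        · exact successFrom_pos_ngeq hH h1 h2

/-- As for KBO, the precedence matters only for the evaluation. There the walk is followed to the
first node of each column that does not hand it on within the column. -/
theorem LPOChange.exists_isExpansion (h : LPOChange prec D H) :
    ∃ n entry new, IsExpansion D H n entry new ∧
      (IsStrictTotalOrder (Symbol L) prec → ∀ σ m, FollowedEdge (LPO prec) w D σ n m →
        successFrom (LPO prec) w H σ entry = successFrom (LPO prec) w H σ m) := by
  cases h with
  | @gt k m f g ss ts n n₁ n₂ n₃ c hn hp hlast hrep =>
    have hsize := arity_lt_termSize g ts
    refine ⟨n, c 0, _, .of_cmp hrep hn ?_ ?_ ?_, ?_⟩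
    · refine isTopological_ofFn (.inl hlast) fun i =>
        Node.cmp_spec ?_ (by simp) (by simp) (by simp)
      have := termSize_arg_lt g ts i
      omega
    · simp only [List.length_ofFn]
      omega
    · refine (name_zero_cases (T := {c | c = n₁ ∨ c = n₂ ∨ c = n₃}) (.inl hlast)).imp_right ?_
      rintro ⟨j, hj⟩
      rw [hj]
      simp only [List.map_ofFn, List.mem_ofFn]
      exact ⟨j, rfl⟩
    · intro _ σ a ha
      have hc : ∀ i : Fin m, H (c i.castSucc) =
          some (.cmp (.func f ss) (ts i) (c i.succ) n₃ n₃) :=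
        fun i => hrep.eq_of_mem (List.mem_ofFn.2 ⟨i, rfl⟩)
      have hiff : LPO prec (σ.app (.func f ss)) (σ.app (.func g ts)) ↔
          ∀ i, LPO prec (σ.app (.func f ss)) (σ.app (ts i)) := LPO.iff_of_prec hp
      have hne : σ.app (.func f ss) ≠ σ.app (.func g ts) := func_ne_of_prec hp
      rcases ha.cmp_cases hn with ⟨h1, rfl⟩ | ⟨-, h1, -⟩ | ⟨h1, -, rfl⟩
      · rw [Fin.eq_of_chain (F := fun i => successFrom (LPO prec) w H σ (c i))
          (Fin.zero_le (Fin.last m)) fun j _ _ => successFrom_cmp_gt (hc j) (hiff.1 h1 j), hlast]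
      · exact absurd h1 hne
      · rw [hiff] at h1
        push Not at h1
        obtain ⟨i, hi, hfirst⟩ := Fin.exists_first h1
        rw [Fin.eq_of_chain (F := fun i => successFrom (LPO prec) w H σ (c i))
          (Fin.zero_le i.castSucc) fun j _ hj =>
            successFrom_cmp_gt (hc j) (not_not.1 (hfirst j hj))]
        exact successFrom_cmp_not_gt (hc i) hi
  | @eq k f ss ts n n₁ n₂ n₃ c a b hn hlast halast hblast hrep =>
    have hsize := arity_lt_termSize f ss
    have hlt := termSize_arg_lt f ss
    have hlt' := termSize_arg_lt f ts
    refine ⟨n, c 0, _, .of_cmp hrep hn ?_ ?_ ?_, ?_⟩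
    -- The middle column comes first in the list because its edges also lead into the two others;
    -- these lead only downwards or out of the expansion.
    · refine .append (.append ?_ ?_) ?_
      · rw [List.ofFn_eq_map]
        refine isTopological_map (List.pairwise_lt_finRange k) fun i _ => ⟨trivial, ?_, ?_⟩
        · have := hlt i
          have := hlt' i
          simp only [Node.size]
          omega
        · intro ℓ m hm
          have h1 := name_succ_cases (T := {c | c = n₁ ∨ c = n₂ ∨ c = n₃}) (c := c)
            (.inr (.inl hlast)) i
          have h2 := name_succ_cases (T := {c | c = n₁ ∨ c = n₂ ∨ c = n₃}) (c := a)
            (.inl halast) i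
          have h3 := name_succ_cases (T := {c | c = n₁ ∨ c = n₂ ∨ c = n₃}) (c := b)
            (.inr (.inr hblast)) i
          cases ℓ <;> cases hm
          · rcases h2 with h2 | ⟨j, hij, hj⟩
            · exact .inl (.inl (.inl h2))
            · rw [hj]
              exact .inl (.inr (List.mem_map.2
                ⟨_, List.mem_map.2 ⟨j, mem_tail_finRange hij, rfl⟩, rfl⟩))
          · rcases h1 with h1 | ⟨j, hij, hj⟩
            · exact .inl (.inl (.inl h1))
            · exact .inr ⟨j, List.mem_finRange j, hij, hj⟩
          · rcases h3 with h3 | ⟨j, hij, hj⟩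
            · exact .inl (.inl (.inl h3))
            · rw [hj]
              exact .inl (.inl (.inr (List.mem_map.2
                ⟨_, List.mem_map.2 ⟨j, mem_tail_finRange hij, rfl⟩, rfl⟩)))
      · refine isTopological_map_tail (.inl (.inl halast)) fun i =>
          Node.cmp_spec ?_ (by simp) (by simp) (by simp)
        have := hlt' i
        omega
      · refine isTopological_map_tail (.inr (.inr hblast)) fun i =>
          Node.cmp_spec ?_ (by simp) (by simp) (by simp)
        have := hlt i
        omega
    · simp only [List.length_append, List.length_map, List.length_tail, List.length_finRange,
        List.length_ofFn]
      omega
    · refine (name_zero_cases (T := {c | c = n₁ ∨ c = n₂ ∨ c = n₃}) (c := c)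
        (.inr (.inl hlast))).imp_right ?_
      rintro ⟨j, hj⟩
      rw [hj]
      exact List.mem_map.2 ⟨_, List.mem_append_left _ (List.mem_append_left _
        (List.mem_ofFn.2 ⟨j, rfl⟩)), rfl⟩
    · intro _ σ m hm
      have hc : ∀ i : Fin k, H (c i.castSucc) =
          some (.cmp (ss i) (ts i) (a i.succ) (c i.succ) (b i.succ)) := fun i =>
        hrep.eq_of_mem (List.mem_append_left _ (List.mem_append_left _
          (List.mem_ofFn.2 ⟨i, rfl⟩)))
      have ha : ∀ i j : Fin k, i < j → H (a j.castSucc) =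
          some (.cmp (.func f ss) (ts j) (a j.succ) n₃ n₃) := fun i j hij =>
        hrep.eq_of_mem (List.mem_append_left _ (List.mem_append_right _
          (List.mem_map.2 ⟨j, mem_tail_finRange hij, rfl⟩)))
      have hb : ∀ i j : Fin k, i < j → H (b j.castSucc) =
          some (.cmp (ss j) (.func f ts) n₁ n₁ (b j.succ)) := fun i j hij =>
        hrep.eq_of_mem (List.mem_append_right _
          (List.mem_map.2 ⟨j, mem_tail_finRange hij, rfl⟩))
      have happ : σ.app (.func f ss) = σ.app (.func f ts) ↔
          ∀ i, σ.app (ss i) = σ.app (ts i) := by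
        rw [Subst.app_func, Subst.app_func]
        simp [funext_iff]
      have hcases := hm.cmp_cases hn
      by_cases h3 : ∃ i, LPO prec (σ.app (ss i)) (σ.app (ts i)) ∨ σ.app (ss i) ≠ σ.app (ts i)
      · obtain ⟨i, hi, hfirst⟩ := Fin.exists_first h3
        push Not at hfirst
        rw [Fin.eq_of_chain (F := fun i => successFrom (LPO prec) w H σ (c i))
          (Fin.zero_le i.castSucc) fun j _ hj => successFrom_cmp_eq (hc j)
            (hfirst j hj).1 (hfirst j hj).2]
        by_cases h4 : LPO prec (σ.app (ss i)) (σ.app (ts i))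
        · have hiff : LPO prec (σ.app (.func f ss)) (σ.app (.func f ts)) ↔
              ∀ j, i < j → LPO prec (σ.app (.func f ss)) (σ.app (ts j)) :=
            LPO.iff_of_arg_gt (fun j hj => (hfirst j hj).2) h4
          have hne : σ.app (.func f ss) ≠ σ.app (.func f ts) := by
            intro h
            rw [happ.1 h i] at h4
            exact LPO.irrefl _ h4
          rw [successFrom_cmp_gt (hc i) h4]
          rcases hcases with ⟨h, rfl⟩ | ⟨-, h, -⟩ | ⟨h, -, rfl⟩
          -- Row `i` of the middle column hands over to row `i + 1` of the left one, so the stretch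
          -- starts at `i.succ`.
          · rw [Fin.eq_of_chain (F := fun i => successFrom (LPO prec) w H σ (a i))
              (Fin.le_last i.succ) fun j hj _ =>
                successFrom_cmp_gt (ha i j (Fin.succ_le_castSucc_iff.1 hj))
                  (hiff.1 h j (Fin.succ_le_castSucc_iff.1 hj)), halast]
          · exact absurd h hne
          · rw [hiff] at h
            push Not at h
            obtain ⟨j, ⟨hij, hj⟩, hfirst'⟩ := Fin.exists_first h
            rw [Fin.eq_of_chain (F := fun i => successFrom (LPO prec) w H σ (a i))
              (Fin.succ_le_castSucc_iff.2 hij) fun l hl hl' =>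
                successFrom_cmp_gt (ha i l (Fin.succ_le_castSucc_iff.1 hl))
                  (not_not.1 fun hn => hfirst' l hl' ⟨Fin.succ_le_castSucc_iff.1 hl, hn⟩)]
            exact successFrom_cmp_not_gt (ha i j hij) hj
        · have h5 := hi.resolve_left h4
          have hiff : LPO prec (σ.app (.func f ss)) (σ.app (.func f ts)) ↔
              ∃ j, i < j ∧ (σ.app (ss j) = σ.app (.func f ts) ∨
                LPO prec (σ.app (ss j)) (σ.app (.func f ts))) :=
            LPO.iff_of_arg_not_ge (fun j hj => (hfirst j hj).2) h4 h5
          have hne : σ.app (.func f ss) ≠ σ.app (.func f ts) := fun h => h5 (happ.1 h i)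
          rw [successFrom_cmp_ngeq (hc i) h4 h5]
          rcases hcases with ⟨h, rfl⟩ | ⟨-, h, -⟩ | ⟨h, -, rfl⟩
          · obtain ⟨j, ⟨hij, hj⟩, hfirst'⟩ := Fin.exists_first (hiff.1 h)
            have hnot : ∀ l, i < l → l < j → ¬ (σ.app (ss l) = σ.app (.func f ts) ∨
                LPO prec (σ.app (ss l)) (σ.app (.func f ts))) :=
              fun l hl hl' hn => hfirst' l hl' ⟨hl, hn⟩
            rw [Fin.eq_of_chain (F := fun i => successFrom (LPO prec) w H σ (b i))
              (Fin.succ_le_castSucc_iff.2 hij) fun l hl hl' =>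
                successFrom_cmp_ngeq (hb i l (Fin.succ_le_castSucc_iff.1 hl))
                  (fun hn => hnot l (Fin.succ_le_castSucc_iff.1 hl) hl' (.inr hn))
                  (fun hn => hnot l (Fin.succ_le_castSucc_iff.1 hl) hl' (.inl hn))]
            exact successFrom_cmp_geq (hb i j hij) hj
          · exact absurd h hne
          · rw [hiff] at h
            push Not at h
            rw [Fin.eq_of_chain (F := fun i => successFrom (LPO prec) w H σ (b i))
              (Fin.le_last i.succ) fun j hj _ =>
                successFrom_cmp_ngeq (hb i j (Fin.succ_le_castSucc_iff.1 hj))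
                  (h j (Fin.succ_le_castSucc_iff.1 hj)).2
                  (h j (Fin.succ_le_castSucc_iff.1 hj)).1, hblast]
      · push Not at h3
        rw [Fin.eq_of_chain (F := fun i => successFrom (LPO prec) w H σ (c i))
          (Fin.zero_le (Fin.last k)) fun j _ _ => successFrom_cmp_eq (hc j) (h3 j).1 (h3 j).2]
        have heq := happ.2 fun i => (h3 i).2
        rcases hcases with ⟨h, -⟩ | ⟨-, -, rfl⟩ | ⟨-, h, -⟩
        -- Here irreflexivity is needed: with all arguments equal, `n` must not take its `>`-edge,
        -- since the middle column ends in `n₂`.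
        · rw [heq] at h
          exact absurd h (LPO.irrefl _)
        · rw [hlast]
        · exact absurd heq h
  | @lt k m f g ss ts n n₁ n₂ n₃ c hn hp hlast hrep =>
    have hsize := arity_lt_termSize f ss
    refine ⟨n, c 0, _, .of_cmp hrep hn ?_ ?_ ?_, ?_⟩
    · refine isTopological_ofFn (.inr (.inr hlast)) fun i =>
        Node.cmp_spec ?_ (by simp) (by simp) (by simp)
      have := termSize_arg_lt f ss i
      omega
    · simp only [List.length_ofFn]
      omega
    · refine (name_zero_cases (T := {c | c = n₁ ∨ c = n₂ ∨ c = n₃})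
        (.inr (.inr hlast))).imp_right ?_
      rintro ⟨j, hj⟩
      rw [hj]
      simp only [List.map_ofFn, List.mem_ofFn]
      exact ⟨j, rfl⟩
    · intro _ σ a ha
      have hc : ∀ i : Fin k, H (c i.castSucc) =
          some (.cmp (ss i) (.func g ts) n₁ n₁ (c i.succ)) :=
        fun i => hrep.eq_of_mem (List.mem_ofFn.2 ⟨i, rfl⟩)
      have hiff : LPO prec (σ.app (.func f ss)) (σ.app (.func g ts)) ↔
          ∃ i, σ.app (ss i) = σ.app (.func g ts) ∨
            LPO prec (σ.app (ss i)) (σ.app (.func g ts)) := LPO.iff_of_prec_swap hp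
      have hne : σ.app (.func f ss) ≠ σ.app (.func g ts) := (func_ne_of_prec hp).symm
      rcases ha.cmp_cases hn with ⟨h1, rfl⟩ | ⟨-, h1, -⟩ | ⟨h1, -, rfl⟩
      · obtain ⟨i, hi, hfirst⟩ := Fin.exists_first (hiff.1 h1)
        rw [Fin.eq_of_chain (F := fun i => successFrom (LPO prec) w H σ (c i))
          (Fin.zero_le i.castSucc) fun j _ hj => successFrom_cmp_ngeq (hc j)
            (fun h => hfirst j hj (.inr h)) fun h => hfirst j hj (.inl h)]
        exact successFrom_cmp_geq (hc i) hi
      · exact absurd h1 hne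
      · rw [hiff] at h1
        push Not at h1
        rw [Fin.eq_of_chain (F := fun i => successFrom (LPO prec) w H σ (c i))
          (Fin.zero_le (Fin.last k)) fun j _ _ =>
            successFrom_cmp_ngeq (hc j) (h1 j).2 (h1 j).1, hlast]

end Changes

/-! ### Generic transformations -/

section Generic

variable {D D' H : Diagram L V} {r : L.Term V → L.Term V → Prop} {w : Symbol L → ℕ}
  {n₁ n n₂ n₃ : ℕ} {ℓ ℓ' : EdgeLabel}

theorem Diagram.redirect_of_ne {m : ℕ} (hm : m ≠ n₁) : D.redirect n₁ ℓ n₂ m = D m := by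
  simp [Diagram.redirect, hm]

theorem Diagram.redirect_self {nd : Node L V} (h : D n₁ = some nd) :
    D.redirect n₁ ℓ n₂ n₁ = some (nd.mapEdges fun ℓ' a => if ℓ' = ℓ then n₂ else a) := by
  simp [Diagram.redirect, h]

theorem Diagram.exists_redirect_eq (h : D.Edge n₁ ℓ n) {m : ℕ} {nd : Node L V}
    (hm : D m = some nd) : ∃ φ, D.redirect n₁ ℓ n₂ m = some (nd.mapEdges φ) ∧
      ∀ ℓ' a, nd.succ ℓ' = some a → Corresponds n n₂ True a (φ ℓ' a) := by
  by_cases hm₁ : m = n₁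
  · subst hm₁
    refine ⟨_, redirect_self hm, fun ℓ' a ha => ?_⟩
    split_ifs with hℓ
    · subst hℓ
      obtain ⟨nd', h1, h2⟩ := h
      obtain rfl := Option.some_inj.1 (hm.symm.trans h1)
      exact .inr ⟨Option.some_inj.1 (ha.symm.trans h2), rfl⟩
    · exact .inl ⟨rfl, .inr trivial⟩
  · refine ⟨fun _ a => a, ?_, fun ℓ' a _ => .inl ⟨rfl, .inr trivial⟩⟩
    rw [redirect_of_ne hm₁, hm, Node.mapEdges_id]

theorem Diagram.redirect_ne_none_iff {m : ℕ} : D.redirect n₁ ℓ n₂ m ≠ none ↔ D m ≠ none := by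
  by_cases hm₁ : m = n₁
  · subst hm₁
    simp [redirect]
  · rw [redirect_of_ne hm₁]

/-- No node is added, and `n` stays at least until the clean-up; `alt` is a child of `n`. -/
theorem isModification_redundant (h : D.Edge n₁ ℓ' n) (hf : Forces r w D n ℓ)
    (hn : D.Edge n ℓ n₂) : IsModification D (D.redirect n₁ ℓ' n₂) n n₂ True ∅ where
  inner := by
    obtain ⟨nd, hnd, he, -⟩ := hf
    exact ⟨nd, hnd, he.isInner⟩
  fresh := by simp
  finite := Set.finite_empty
  old := fun m nd hm _ => Diagram.exists_redirect_eq h hm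
  exhaustive := fun m hm => .inr ⟨Diagram.redirect_ne_none_iff.1 hm, .inr trivial⟩
  new := ⟨fun _ => 0, by simp⟩
  alt_mem := .inr ⟨ℓ, hn⟩
  redirected := by
    obtain ⟨nd, h1, h2⟩ := h
    refine ⟨n₁, ℓ', nd, _, h1, h2, Diagram.redirect_self h1, ?_⟩
    simp [Node.succ_mapEdges, h2]

/-- The diagram in which the edge from `n₁` labeled `ℓ` leads to a copy `n₂` of `n`. -/
def Diagram.replicate (D : Diagram L V) (n₁ : ℕ) (ℓ : EdgeLabel) (n n₂ : ℕ) : Diagram L V :=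
  Function.update (D.redirect n₁ ℓ n₂) n₂ (D n)

theorem Diagram.replicate_self : D.replicate n₁ ℓ n n₂ n₂ = D n := by
  simp [replicate]

theorem Diagram.replicate_of_ne {m : ℕ} (hm : m ≠ n₂) :
    D.replicate n₁ ℓ n n₂ m = D.redirect n₁ ℓ n₂ m := by
  simp [replicate, hm]

theorem isModification_replicate (hD : IsTOD D) (h : D.Edge n₁ ℓ n) (hexit : ¬ D.IsExit n)
    (hn₂ : D n₂ = none) : IsModification D (D.replicate n₁ ℓ n n₂) n n₂ True {n₂} := by
  have hne : ∀ m nd, D m = some nd → m ≠ n₂ := by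
    rintro m nd hm rfl
    simp [hn₂] at hm
  obtain ⟨nd, hnd⟩ := Option.ne_none_iff_exists'.1 (hD.edge_closed n₁ n ⟨ℓ, h⟩)
  have hin : nd.IsInner := by
    cases nd with
    | root a => exact hD.not_adj_root ⟨a, hnd⟩ ⟨ℓ, h⟩
    | exit => exact hexit hnd
    | _ => trivial
  refine ⟨⟨nd, hnd, hin⟩, by simp [hn₂], Set.finite_singleton _, ?_, ?_, ?_, .inl rfl, ?_⟩
  · intro m nd' hm _
    rw [Diagram.replicate_of_ne (hne m nd' hm)]
    exact Diagram.exists_redirect_eq h hm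
  · intro m hm
    by_cases hm₂ : m = n₂
    · exact .inl hm₂
    · rw [Diagram.replicate_of_ne hm₂, Diagram.redirect_ne_none_iff] at hm
      exact .inr ⟨hm, .inr trivial⟩
  · refine ⟨fun _ => 0, ?_⟩
    rintro m rfl
    exact ⟨nd, Diagram.replicate_self.trans hnd, hin, fun ℓ c hc =>
      .inr (Diagram.adj_of_succ hnd hc)⟩
  · obtain ⟨nd₁, h1, h2⟩ := h
    refine ⟨n₁, ℓ, nd₁, _, h1, h2,
      (Diagram.replicate_of_ne (hne _ _ h1)).trans (Diagram.redirect_self h1), ?_⟩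
    simp [Node.succ_mapEdges, h2]

theorem Diagram.Edge.replicate {m p : ℕ} {ℓ'' : EdgeLabel} (h : D.Edge p ℓ'' m)
    (hne : (p, ℓ'') ≠ (n₁, ℓ)) (hn₂ : D n₂ = none) : (D.replicate n₁ ℓ n n₂).Edge p ℓ'' m := by
  obtain ⟨nd, h1, h2⟩ := h
  have hp : p ≠ n₂ := by
    rintro rfl
    simp [hn₂] at h1
  rw [Diagram.Edge, replicate_of_ne hp]
  by_cases hp₁ : p = n₁
  · subst hp₁
    refine ⟨_, redirect_self h1, ?_⟩
    have hℓ : ℓ'' ≠ ℓ := by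
      rintro rfl
      exact hne rfl
    simp [Node.succ_mapEdges, h2, hℓ]
  · rw [redirect_of_ne hp₁]
    exact ⟨nd, h1, h2⟩

/-- The copy has the redirected edge, `n` keeps its second incoming edge, and no other node loses
one. So the clean-up does nothing, and the replicated diagram really has one node more. -/
theorem not_removeOrphan_replicate (hD : IsTOD D) (h : D.Edge n₁ ℓ n) (h₃ : D.Edge n₃ ℓ' n)
    (hne : (n₃, ℓ') ≠ (n₁, ℓ)) (hexit : ¬ D.IsExit n) (hn₂ : D n₂ = none) :
    ¬ RemoveOrphan (D.replicate n₁ ℓ n n₂) H := by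
  have hmod := isModification_replicate hD h hexit hn₂
  rintro ⟨m, hm, hroot, horph, -⟩
  rw [hmod.isRoot_iff] at hroot
  by_cases hm₂ : m = n₂
  · subst hm₂
    obtain ⟨p, ℓ, nd, nd', -, -, h3, h4⟩ := hmod.redirected
    exact horph p (Diagram.adj_of_succ h3 h4)
  by_cases hmn : m = n
  · subst hmn
    exact horph n₃ ⟨ℓ', h₃.replicate hne hn₂⟩
  · rw [Diagram.replicate_of_ne hm₂, Diagram.redirect_ne_none_iff] at hm
    obtain ⟨root, hr, -⟩ := hD.root_unique
    rcases (hD.reachable_from_root root m hr hm).cases_tail with rfl | ⟨p, -, ℓ'', hp⟩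
    · exact hroot hr
    · refine horph p ⟨ℓ'', hp.replicate ?_ hn₂⟩
      rintro heq
      cases heq
      obtain ⟨nd, h1, h2⟩ := h
      obtain ⟨nd', h3, h4⟩ := hp
      obtain rfl := Option.some_inj.1 (h1.symm.trans h3)
      exact hmn (Option.some_inj.1 (h4.symm.trans h2))

theorem ncard_replicate (hD : IsTOD D) (h : D.Edge n₁ ℓ n) (hn₂ : D n₂ = none) :
    {m | D.replicate n₁ ℓ n n₂ m ≠ none}.ncard = {m | D m ≠ none}.ncard + 1 := by
  have hset : {m | D.replicate n₁ ℓ n n₂ m ≠ none} = insert n₂ {m | D m ≠ none} := by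
    ext m
    by_cases hm : m = n₂
    · subst hm
      simpa [Diagram.replicate_self] using hD.edge_closed n₁ n ⟨ℓ, h⟩
    · simp only [Set.mem_ofPred_eq, Set.mem_insert_iff, hm, false_or]
      rw [Diagram.replicate_of_ne hm, Diagram.redirect_ne_none_iff]
  rw [hset, Set.ncard_insert_of_notMem (by simp [hn₂]) hD.finite]

theorem Cleanup.eq_of_not_removeOrphan (h : Cleanup H D') (h' : ∀ E, ¬ RemoveOrphan H E) :
    D' = H := by
  rcases h.1.cases_head with rfl | ⟨E, hE, -⟩
  · rfl
  · exact absurd hE (h' E)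

end Generic

/-! ### Correctness and termination -/

section Main

variable {D D' : Diagram L V} {r : L.Term V → L.Term V → Prop} {w : Symbol L → ℕ}
  {prec : Symbol L → Symbol L → Prop}

theorem preserves_of_isExpansion {C : Diagram L V → Diagram L V → Prop}
    (h : ∀ D H, C D H → ∃ n entry new, IsExpansion D H n entry new ∧
      ∀ σ m, FollowedEdge r w D σ n m →
        successFrom r w H σ entry = successFrom r w H σ m) : Preserves r w C := by
  rintro D D' hD ⟨H, hC, hclean⟩
  obtain ⟨n, entry, new, hexp, hs⟩ := h D H hC
  have hmod := hexp.isModification hD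
  refine ⟨hclean.isTOD (hmod.isRootedDAG hD.isRootedDAG), hmod.equivalent hD hclean ?_⟩
  intro σ _ hch
  obtain ⟨nd, k, hnd, hi, hsize, -⟩ := hexp.exists_node
  -- The other kinds of nodes have size 0, contrary to `hsize`.
  have he : nd.IsEval := by
    cases nd <;> trivial
  have hne : nd ≠ .exit := by
    rintro rfl
    exact hi
  obtain ⟨m, hm⟩ := Node.exists_succ_evalLabel r w σ hne
  rw [hs σ m ⟨nd, hnd, hm⟩, hch m ⟨nd, hnd, hm⟩, successFrom_eq_of_isEval hnd he hm]

theorem preserves_genericChange : Preserves r w (GenericChange (V := V) r w) := by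
  rintro D D' hD ⟨H, hC, hclean⟩
  cases hC with
  | @redundant n₁ n n₂ ℓ' ℓ h hf hn =>
    have hmod := isModification_redundant h hf hn
    refine ⟨hclean.isTOD (hmod.isRootedDAG hD.isRootedDAG), hmod.equivalent hD hclean ?_⟩
    intro σ hreach hch
    obtain ⟨nd, hnd, he, hall⟩ := hf
    obtain ⟨nd', h1, h2⟩ := hn
    obtain rfl := Option.some_inj.1 (hnd.symm.trans h1)
    -- The forced label is available because the walk for `σ` is known to reach `n`.
    rw [← hall σ hreach] at h2
    rw [hch n₂ ⟨nd, hnd, h2⟩, successFrom_eq_of_isEval hnd he h2]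
  | @replicate n₁ n n₂ n₃ ℓ ℓ' h hexit h₃ hne hn₂ =>
    change Cleanup (D.replicate n₁ ℓ n n₂) D' at hclean
    have hmod := isModification_replicate hD h hexit hn₂
    refine ⟨hclean.isTOD (hmod.isRootedDAG hD.isRootedDAG), hmod.equivalent hD hclean ?_⟩
    intro σ _ hch
    obtain ⟨nd, hnd⟩ := Option.ne_none_iff_exists'.1 (hD.edge_closed n₁ n ⟨ℓ, h⟩)
    ext q
    rw [mem_successFrom_iff hnd, mem_successFrom_iff (Diagram.replicate_self.trans hnd)]
    refine or_congr_right (exists_congr fun c => and_congr_right fun hc => ?_)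
    rw [hch c ⟨nd, hnd, hc⟩]

theorem IsModification.transforms_lt {H : Diagram L V} {n alt : ℕ} {keep : Prop} {N : Set ℕ}
    (h : IsModification D H n alt keep N) (hD : IsTOD D) (hclean : Cleanup H D')
    (halt : ∀ W W', IsUnfoldingSize D W → IsUnfoldingSize H W' →
      (∀ c, D.Adj n c → W' c ≤ W c) → W' alt < W n)
    {W W' : ℕ → ℕ} (hW : IsUnfoldingSize D W) (hW' : IsUnfoldingSize D' W') {a a' : ℕ}
    (ha : D.IsRoot a) (ha' : D'.IsRoot a') : W' a' < W a := by
  have hH := h.isRootedDAG hD.isRootedDAG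
  -- The comparison takes place in `H`, before the clean-up; the root has the same size afterwards.
  obtain ⟨U, hU⟩ := hH.exists_isUnfoldingSize
  obtain rfl := hD.root_unique.unique ha (h.isRoot_iff.1 (hclean.isRoot_iff.1 ha'))
  have hne : D' a ≠ none := by
    obtain ⟨c, hc⟩ := ha'
    simp [hc]
  rw [hU.eq_of_le hH (hclean.isTOD hH).isRootedDAG (fun _ _ => hclean.le) hW' a hne]
  exact h.unfoldingSize_root_lt hD hW hU (halt W U hW hU) ha

/-- The second alternative is for replication: the copy has the children of `n` and thus no greater
size, while the diagram gains a node. -/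
theorem AnyChange.transforms_decreasing (hD : IsTOD D)
    (h : Transforms (AnyChange r prec w) D D') :
    IsTOD D' ∧ ∀ W W' a a', IsUnfoldingSize D W → IsUnfoldingSize D' W' → D.IsRoot a →
      D'.IsRoot a' → W' a' < W a ∨
        (W' a' ≤ W a ∧ {m | D m ≠ none}.ncard < {m | D' m ≠ none}.ncard) := by
  obtain ⟨H, hC, hclean⟩ := h
  have hexpansion : (∃ n entry new, IsExpansion D H n entry new) → IsTOD D' ∧
      ∀ W W' a a', IsUnfoldingSize D W → IsUnfoldingSize D' W' → D.IsRoot a →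
        D'.IsRoot a' → W' a' < W a ∨
          (W' a' ≤ W a ∧ {m | D m ≠ none}.ncard < {m | D' m ≠ none}.ncard) := by
    rintro ⟨n, entry, new, hexp⟩
    have hmod := hexp.isModification hD
    refine ⟨hclean.isTOD (hmod.isRootedDAG hD.isRootedDAG), ?_⟩
    intro W W' a a' hW hW' ha ha'
    exact .inl (hmod.transforms_lt hD hclean
      (fun _ _ hU hU' hle => hexp.unfoldingSize_entry_lt hU hU' hle) hW hW' ha ha')
  rcases hC with hC | hC | hC
  · cases hC with
    | @redundant n₁ n n₂ ℓ' ℓ h hf hn =>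
      have hmod := isModification_redundant h hf hn
      refine ⟨hclean.isTOD (hmod.isRootedDAG hD.isRootedDAG), ?_⟩
      intro W W' a a' hW hW' ha ha'
      refine .inl (hmod.transforms_lt hD hclean (fun U U' hU _ hle => ?_) hW hW' ha ha')
      obtain ⟨nd, h1, h2⟩ := id hn
      rw [hU n nd h1]
      exact (hle n₂ ⟨ℓ, hn⟩).trans_lt (Node.lt_unfold U h2)
    | @replicate n₁ n n₂ n₃ ℓ ℓ' h hexit h₃ hne hn₂ =>
      change Cleanup (D.replicate n₁ ℓ n n₂) D' at hclean
      have hmod := isModification_replicate hD h hexit hn₂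
      refine ⟨hclean.isTOD (hmod.isRootedDAG hD.isRootedDAG), ?_⟩
      obtain rfl := hclean.eq_of_not_removeOrphan fun E =>
        not_removeOrphan_replicate hD h h₃ hne hexit hn₂
      intro W W' a a' hW hW' ha ha'
      refine .inr ⟨?_, by rw [ncard_replicate hD h hn₂]; exact Nat.lt_succ_self _⟩
      obtain rfl := hD.root_unique.unique ha (hmod.isRoot_iff.1 ha')
      have hne : D a ≠ none := by
        obtain ⟨c, hc⟩ := ha
        simp [hc]
      refine hmod.unfoldingSize_le hD.isRootedDAG hW hW' (fun hle => ?_) a a hne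
        (.inl ⟨rfl, .inr trivial⟩)
      obtain ⟨nd, hnd⟩ := Option.ne_none_iff_exists'.1 (hD.edge_closed n₁ n ⟨ℓ, h⟩)
      rw [hW n nd hnd, hW' n₂ nd (Diagram.replicate_self.trans hnd)]
      simpa only [Node.mapEdges_id] using Node.unfold_mapEdges_le (φ := fun _ a => a)
        fun ℓ a ha => hle a (Diagram.adj_of_succ hnd ha)
  · obtain ⟨n, entry, new, hexp, -⟩ := hC.exists_isExpansion
    exact hexpansion ⟨n, entry, new, hexp⟩
  · obtain ⟨n, entry, new, hexp, -⟩ := hC.exists_isExpansion (w := w)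
    exact hexpansion ⟨n, entry, new, hexp⟩

theorem not_exists_infinite_transforms (r : L.Term V → L.Term V → Prop)
    (prec : Symbol L → Symbol L → Prop) (w : Symbol L → ℕ) :
    ¬ ∃ D : ℕ → Diagram L V, IsTOD (D 0) ∧
      ∀ i, Transforms (AnyChange r prec w) (D i) (D (i + 1)) := by
  rintro ⟨D, h0, hs⟩
  have hD : ∀ i, IsTOD (D i) := by
    intro i
    induction i with
    | zero => exact h0
    | succ i ih => exact (AnyChange.transforms_decreasing ih (hs i)).1
  choose W hW using fun i => (hD i).isRootedDAG.exists_isUnfoldingSize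
  choose a ha using fun i => (hD i).root_unique.exists
  -- When the first component stays the same, the number of nodes has grown, and as it never exceeds
  -- the size at the root, the truncated difference really drops.
  have hanti : StrictAnti fun i =>
      toLex (W i (a i), W i (a i) - {m | D i m ≠ none}.ncard) := by
    refine strictAnti_nat_of_succ_lt fun i => ?_
    have hcard := (hW (i + 1)).ncard_le (hD (i + 1)) (ha (i + 1))
    have hstep := (AnyChange.transforms_decreasing (hD i) (hs i)).2 _ _ _ _ (hW i) (hW (i + 1))
      (ha i) (ha (i + 1))
    rw [Prod.Lex.toLex_lt_toLex]
    dsimp only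
    omega
  exact not_strictAnti_of_wellFoundedLT _ hanti

end Main

end TOD

theorem theorem1 {L : FirstOrder.Language} {V : Type*}
    (prec : TOD.Symbol L → TOD.Symbol L → Prop) [IsStrictTotalOrder (TOD.Symbol L) prec]
    (w : TOD.Symbol L → ℕ) :
    (∀ r : L.Term V → L.Term V → Prop,
      ¬ ∃ D : ℕ → TOD.Diagram L V, TOD.IsTOD (D 0) ∧
        ∀ i, TOD.Transforms (TOD.AnyChange r prec w) (D i) (D (i + 1))) ∧
    (∀ r : L.Term V → L.Term V → Prop, TOD.Preserves r w (TOD.GenericChange r w)) ∧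
    TOD.Preserves (TOD.KBO (V := V) prec w) w (TOD.KBOChange prec w) ∧
    TOD.Preserves (TOD.LPO (V := V) prec) w (TOD.LPOChange prec) := by
  refine ⟨fun r => TOD.not_exists_infinite_transforms r prec w,
    fun r => TOD.preserves_genericChange, ?_, ?_⟩
  · refine TOD.preserves_of_isExpansion fun D H hC => ?_
    obtain ⟨n, entry, new, hexp, hs⟩ := TOD.KBOChange.exists_isExpansion hC
    exact ⟨n, entry, new, hexp, hs inferInstance⟩
  · refine TOD.preserves_of_isExpansion fun D H hC => ?_
    obtain ⟨n, entry, new, hexp, hs⟩ := TOD.LPOChange.exists_isExpansion (w := w) hC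
    exact ⟨n, entry, new, hexp, hs inferInstance⟩
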